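/- Let $F$ be a germ at $0$ of a holomorphic diffeomorphism of $\mathbb C^n$ ($n\ge 1$) with $F(0)=0$, whose differential $dF_0$ is diagonal with diagonal entries $\lambda_1,\dots,\lambda_n$. Suppose that $\lambda_1$ is a primitive $q$-th root of unity, $q\ge 1$, and that $|\lambda_j|<1$ for $j=2,\dots,n$. Then $F$ is one-resonant with respect to $\lambda_1$ with index of resonance $\alpha=(q,0,\dots,0)$: for multi-indices $l\in\mathbb N^n$ with $|l|\ge 2$, one has $\lambda_1=\lambda_1^{l_1}\cdots\lambda_n^{l_n}$ exactly when $l=s\alpha+e_1$ for some integer $s\ge1$. We say that $F$ is formally linearizable in the first component if it is conjugate, by a formal change of coordinates fixing $0$ with invertible linear part, to a formal map $G$ with $G_1(z)=\lambda_1z_1$. The order $k\in\{1,2,\dots\}\cup\{\infty\}$ of $F$ with respect to $\lambda_1$ is the integer $k\ge1$ such that $F$ is formally conjugate to a formal map $G$ with $G_1(z)=\lambda_1z_1+a\,z_1^{qk+1}+O(|z|^{qk+2})$, $a\neq0$, and $k=\infty$ if there is no such integer; there is at most one such integer, so $k$ is well defined. A basin of attraction for $F$ at $0$ is a non-empty open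 set $U\subset\mathbb C^n$ with $0\in\overline U$ for which there is a neighbourhood basis $\{\Omega_i\}$ of $0$ such that $F(U\cap\Omega_i)\subset U\cap\Omega_i$ for all $i$ and $F^{\circ m}(z)\to0$ as $m\to\infty$ for all $z\in U\cap\Omega_i$. Then: 1. If $k<\infty$, there exist $k$ pairwise disjoint basins of attraction for $F$ at $0$, having $0$ on their boundary, each with exactly $q$ connected components $D_0,\dots,D_{q-1}$, which $F$ permutes cyclically: $F(D_p)\subset D_{p+1}$ for $0\le p\le q-1$, where $D_q=D_0$. 2. $k=\infty$ if and only if $F$ is formally linearizable in the first component, and this is the case if and only if there is a germ of a non-singular holomorphic curve through $0$ consisting of fixed points of $F^{\circ q}$. -/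

import Mathlib

open Filter Topology Set

/-- `F` represents a germ at `0` of a holomorphic diffeomorphism of `ℂⁿ` fixing `0`. -/
def IsDiffGerm {n : ℕ} (F : (Fin n → ℂ) → (Fin n → ℂ)) : Prop :=
  AnalyticAt ℂ F 0 ∧ F 0 = 0 ∧
    ∃ G : (Fin n → ℂ) → (Fin n → ℂ), AnalyticAt ℂ G 0 ∧ G 0 = 0 ∧
      ∀ᶠ z in 𝓝 (0 : Fin n → ℂ), G (F z) = z ∧ F (G z) = z

/-- The resonances among `lam`: the pairs `(j, l)` with `|l| ≥ 2` and `lam j = lam ^ l`. -/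
def IsResonance {n : ℕ} (lam : Fin n → ℂ) (j : Fin n) (l : Fin n →₀ ℕ) : Prop :=
  2 ≤ l.degree ∧ lam j = l.prod fun i e => lam i ^ e

/-- One-resonance with respect to the first `m` eigenvalues, with index of resonance `α`. -/
def IsOneResonant {n : ℕ} (lam : Fin n → ℂ) (m : ℕ) (α : Fin n →₀ ℕ) : Prop :=
  α ≠ 0 ∧ (∀ j : Fin n, m ≤ j.val → α j = 0) ∧
    ∀ j : Fin n, j.val < m → ∀ l : Fin n →₀ ℕ,
      IsResonance lam j l ↔ ∃ k : ℕ, 1 ≤ k ∧ l = k • α + Finsupp.single j 1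

/-- The components of `f` are the power series expansions at `0` of the components of `F`. -/
def HasTaylorSeries {n : ℕ} (F : (Fin n → ℂ) → (Fin n → ℂ))
    (f : Fin n → MvPowerSeries (Fin n) ℂ) : Prop :=
  ∀ᶠ z in 𝓝 (0 : Fin n → ℂ), ∀ j : Fin n,
    HasSum (fun d : Fin n →₀ ℕ => MvPowerSeries.coeff d (f j) * d.prod fun i e => z i ^ e) (F z j)

/-- A formal change of coordinates: no constant term and invertible linear part. -/
def IsFormalDiff {n : ℕ} (Φ : Fin n → MvPowerSeries (Fin n) ℂ) : Prop :=
  (∀ j, MvPowerSeries.constantCoeff (Φ j) = 0) ∧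
    IsUnit (Matrix.of fun i j : Fin n => MvPowerSeries.coeff (Finsupp.single j 1) (Φ i))

/-- `F` is formally conjugate to `G`: `Φ ∘ F = G ∘ Φ` for some formal change of coordinates. -/
def FormallyConjugate {n : ℕ} (F : (Fin n → ℂ) → (Fin n → ℂ))
    (G : Fin n → MvPowerSeries (Fin n) ℂ) : Prop :=
  ∃ f Φ : Fin n → MvPowerSeries (Fin n) ℂ, HasTaylorSeries F f ∧ IsFormalDiff Φ ∧
    ∀ j, MvPowerSeries.subst f (Φ j) = MvPowerSeries.subst Φ (G j)

/-- `F` is formally conjugate to some `G` with `G_j(z) = lam_j z_j` for the first `m` indices. -/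
def FormallyLinearizable {n : ℕ} (F : (Fin n → ℂ) → (Fin n → ℂ)) (lam : Fin n → ℂ) (m : ℕ) :
    Prop :=
  ∃ G : Fin n → MvPowerSeries (Fin n) ℂ, FormallyConjugate F G ∧
    ∀ j : Fin n, j.val < m → G j = MvPowerSeries.monomial (Finsupp.single j 1) (lam j)

/-- `F` is formally conjugate to some `G` with
`G_j(z) = lam_j z_j + a_j z^(kα) z_j + O(|z|^(|α| k + 2))` for the first `m` indices,
where `k ≥ 1` and `(a_1, …, a_m) ≠ 0`. -/
def HasResonantForm {n : ℕ} (F : (Fin n → ℂ) → (Fin n → ℂ)) (lam : Fin n → ℂ) (m : ℕ)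
    (α : Fin n →₀ ℕ) (k : ℕ) : Prop :=
  1 ≤ k ∧ ∃ G : Fin n → MvPowerSeries (Fin n) ℂ, FormallyConjugate F G ∧
    ∃ a : Fin n → ℂ, (∃ j : Fin n, j.val < m ∧ a j ≠ 0) ∧
      ∀ j : Fin n, j.val < m → ∀ d : Fin n →₀ ℕ, d.degree < α.degree * k + 2 →
        MvPowerSeries.coeff d (G j) =
          MvPowerSeries.coeff d (MvPowerSeries.monomial (Finsupp.single j 1) (lam j) +
            MvPowerSeries.monomial (k • α + Finsupp.single j 1) (a j))

/-- The order of `F` with respect to the first `m` eigenvalues: the number `k` of the resonant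
form of `F`, and `⊤` if there is no such form. -/
noncomputable def resonanceOrder {n : ℕ} (F : (Fin n → ℂ) → (Fin n → ℂ)) (lam : Fin n → ℂ)
    (m : ℕ) (α : Fin n →₀ ℕ) : ℕ∞ :=
  sInf {x : ℕ∞ | ∃ k : ℕ, HasResonantForm F lam m α k ∧ x = k}

/-- `U` is a basin of attraction for `F` at `0`. -/
def IsBasin {n : ℕ} (F : (Fin n → ℂ) → (Fin n → ℂ)) (U : Set (Fin n → ℂ)) : Prop :=
  U.Nonempty ∧ IsOpen U ∧ (0 : Fin n → ℂ) ∈ closure U ∧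
    ∃ S : Set (Set (Fin n → ℂ)), (𝓝 (0 : Fin n → ℂ)).HasBasis (fun Ω => Ω ∈ S) id ∧
      ∀ Ω ∈ S, MapsTo F (U ∩ Ω) (U ∩ Ω) ∧
        ∀ z ∈ U ∩ Ω, Tendsto (fun i : ℕ => F^[i] z) atTop (𝓝 0)

/-- `U` has exactly `q` connected components, and `F` permutes them cyclically
(meant for `q ≥ 1`). -/
def PermutesComponentsCyclically {n : ℕ} (F : (Fin n → ℂ) → (Fin n → ℂ)) (q : ℕ)
    (U : Set (Fin n → ℂ)) : Prop :=
  ∃ D : ZMod q → Set (Fin n → ℂ), Function.Injective D ∧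
    range D = {C | ∃ x ∈ U, C = connectedComponentIn U x} ∧
    ∀ p : ZMod q, MapsTo F (D p) (D (p + 1))

/-- There is a germ of a non-singular holomorphic curve through `0` of fixed points of `F`. -/
def HasFixedCurve {n : ℕ} (F : (Fin n → ℂ) → (Fin n → ℂ)) : Prop :=
  ∃ γ : ℂ → (Fin n → ℂ), AnalyticAt ℂ γ 0 ∧ γ 0 = 0 ∧ deriv γ 0 ≠ 0 ∧
    ∀ᶠ t in 𝓝 (0 : ℂ), F (γ t) = γ t

/-
The first component of a formal conjugacy of `F` to its normal form, truncated to a polynomial `h`,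
satisfies `h ∘ F = λ₁ h + a h ^ (q k + 1) + O(|z| ^ (q k + 2))`, with `dh₀` a non-zero multiple of
the first coordinate.

As `|λ_j| < 1` for `j ≥ 2`, the equations `F_j^q (z) = z_j`, `j ≥ 2`, can be solved for
`(z_2, …, z_n)` by a holomorphic curve. The defect of this curve in the remaining equation
`F_1^q (z) = z_1` is a holomorphic function of one variable. Following `h` along the curve shows
that the defect vanishes to order exactly `q k + 1` if `k` is finite, and identically if `F` is
formally linearizable in the first component; in the latter case the curve consists of fixed points
of `F^q`.

If `k` is finite, the cone where `|h|` dominates `|z_2|, …, |z_n|` is forward invariant near `0`,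
again because `|λ_j| < 1 = |λ_1|`. On it the terms `O(|z| ^ (q k + 2))` are `O(|h| ^ (q k + 2))`,
and in the coordinate `u = (c / h) ^ (q k)` the map is close to `u ↦ u + 1`. The components of
`{Re u > R}` are `q k` petals, which `F` permutes by multiplying their directions by `λ₁`; the `k`
orbits of this permutation are the basins.
-/

section FormalSeries

open MvPowerSeries

/-- The monomial `z ^ d = ∏ i, z i ^ d i` of a family `z` of numbers, or of power series. -/
noncomputable def multiPow {σ R : Type*} [CommMonoid R] (z : σ → R) (d : σ →₀ ℕ) : R :=
  d.prod fun i m => z i ^ m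

/-- The linear part of the formal map `f` is the diagonal matrix with entries `lam`, and `f` has no
constant term. -/
def HasDiagonalPart {σ R : Type*} [CommRing R] (lam : σ → R) (f : σ → MvPowerSeries σ R) : Prop :=
  ∀ j d, d.degree < 2 → coeff d (f j) = coeff d (monomial (Finsupp.single j 1) (lam j))

/-- The multi-indices of degree less than `N`. -/
noncomputable def indicesBelow (σ : Type*) [Finite σ] (N : ℕ) : Finset (σ →₀ ℕ) :=
  (Finsupp.finite_of_degree_lt (σ := σ) N).toFinset

section MultiPow

variable {σ R : Type*} [CommMonoid R]

@[simp]
lemma multiPow_zero (z : σ → R) : multiPow z 0 = 1 :=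
  Finsupp.prod_zero_index

lemma multiPow_add (z : σ → R) (d e : σ →₀ ℕ) :
    multiPow z (d + e) = multiPow z d * multiPow z e :=
  Finsupp.prod_add_index' (fun _ => pow_zero _) fun _ _ _ => pow_add _ _ _

@[simp]
lemma multiPow_single (z : σ → R) (i : σ) (m : ℕ) : multiPow z (Finsupp.single i m) = z i ^ m :=
  Finsupp.prod_single_index (pow_zero _)

@[simp]
lemma one_multiPow (d : σ →₀ ℕ) : multiPow (1 : σ → R) d = 1 := by
  simp [multiPow]

end MultiPow

lemma mem_indicesBelow {σ : Type*} [Finite σ] {N : ℕ} {d : σ →₀ ℕ} :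
    d ∈ indicesBelow σ N ↔ d.degree < N := by
  simp [indicesBelow]

lemma eq_zero_or_eq_single_of_degree_lt_two {σ : Type*} {d : σ →₀ ℕ} (hd : d.degree < 2) :
    d = 0 ∨ ∃ i, d = Finsupp.single i 1 := by
  classical
  refine or_iff_not_imp_left.2 fun h0 => ?_
  obtain ⟨i, hi⟩ := Finsupp.ne_iff.1 h0
  obtain ⟨e, rfl⟩ := exists_add_of_le (Finsupp.single_le_iff.2 (Nat.one_le_iff_ne_zero.2 hi))
  rw [map_add, Finsupp.degree_single] at hd
  exact ⟨i, by rw [(Finsupp.degree_eq_zero_iff e).1 (by omega), add_zero]⟩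

section Order

variable {σ R : Type*} [CommRing R] {s t : MvPowerSeries σ R}

lemma natCast_le_order_iff {N : ℕ} :
    (N : ℕ∞) ≤ s.order ↔ ∀ d : σ →₀ ℕ, d.degree < N → coeff d s = 0 :=
  ⟨fun h _ hd => coeff_of_lt_order (lt_of_lt_of_le (by exact_mod_cast hd) h), nat_le_order⟩

lemma le_order_add {N : ℕ∞} (hs : N ≤ s.order) (ht : N ≤ t.order) : N ≤ (s + t).order :=
  (le_min hs ht).trans min_order_le_add

lemma le_order_sub {N : ℕ∞} (hs : N ≤ s.order) (ht : N ≤ t.order) : N ≤ (s - t).order := by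
  rw [sub_eq_add_neg]
  exact le_order_add hs (by rwa [order_neg])

lemma le_order_mul_of_left (t : MvPowerSeries σ R) {N : ℕ∞} (hs : N ≤ s.order) :
    N ≤ (s * t).order :=
  (hs.trans le_self_add).trans le_order_mul

lemma le_order_subst [Finite σ] {f : σ → MvPowerSeries σ R} (hf : ∀ j, constantCoeff (f j) = 0)
    {N : ℕ∞} (hs : N ≤ s.order) : N ≤ (subst f s).order :=
  calc N = 1 * N := (one_mul N).symm
    _ ≤ (⨅ j, (f j).order) * s.order :=
      mul_le_mul' (le_iInf fun j => one_le_order_iff_constCoeff_eq_zero.2 (hf j)) hs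
    _ ≤ (subst f s).order :=
      MvPowerSeries.le_order_subst (hasSubst_of_constantCoeff_zero hf) s

end Order

section LeadingPart

variable {σ R : Type*} [CommRing R] {s t s' t' : MvPowerSeries σ R} {p r : ℕ}

/-- `t` is the leading part of `s`, of degree `p`; it is `0` when `s` starts in higher degree. -/
def IsLeading (p : ℕ) (s t : MvPowerSeries σ R) : Prop :=
  (p : ℕ∞) ≤ s.order ∧ homogeneousComponent p s = t

lemma IsLeading.mul (h : IsLeading p s t) (h' : IsLeading r s' t') :
    IsLeading (p + r) (s * s') (t * t') := by
  refine ⟨?_, by rw [homogeneousComponent_mul_of_le_order h.1 h'.1, h.2, h'.2]⟩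
  push_cast
  exact (add_le_add h.1 h'.1).trans le_order_mul

lemma isLeading_one : IsLeading 0 (1 : MvPowerSeries σ R) 1 := by
  refine ⟨by simp, ?_⟩
  classical
  ext d
  simp only [coeff_homogeneousComponent, coeff_one, Finsupp.degree_eq_zero_iff]
  split_ifs <;> rfl

lemma IsLeading.pow (h : IsLeading p s t) (m : ℕ) : IsLeading (m * p) (s ^ m) (t ^ m) := by
  induction m with
  | zero => simpa using isLeading_one
  | succ m ih => simpa [pow_succ, Nat.succ_mul] using ih.mul h

lemma IsLeading.multiPow {f g : σ → MvPowerSeries σ R} (h : ∀ j, IsLeading 1 (f j) (g j))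
    (e : σ →₀ ℕ) : IsLeading e.degree (multiPow f e) (multiPow g e) := by
  induction e using Finsupp.induction_linear with
  | zero => simpa using isLeading_one
  | add a b ha hb => simpa only [multiPow_add, map_add] using ha.mul hb
  | single j m => simpa using (h j).pow m

lemma multiPow_monomial (lam : σ → R) (e : σ →₀ ℕ) :
    multiPow (fun j => (monomial (Finsupp.single j 1) (lam j) : MvPowerSeries σ R)) e =
      monomial e (multiPow lam e) := by
  induction e using Finsupp.induction_linear with
  | zero => simp [monomial_zero_one]
  | add a b ha hb => rw [multiPow_add, multiPow_add, ha, hb, monomial_mul_monomial]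
  | single j m => simp [monomial_pow]

lemma IsLeading.coeff_eq (h : IsLeading p s t) {d : σ →₀ ℕ} (hd : d.degree ≤ p) :
    coeff d s = coeff d t := by
  rw [← h.2, coeff_homogeneousComponent]
  split_ifs with hdp
  · rfl
  · exact natCast_le_order_iff.1 h.1 d (lt_of_le_of_ne hd hdp)

end LeadingPart

namespace HasDiagonalPart

variable {σ K : Type*} [Field K] {lam : σ → K} {f : σ → MvPowerSeries σ K}

lemma constantCoeff_eq_zero (hf : HasDiagonalPart lam f) (j : σ) : constantCoeff (f j) = 0 := by
  classical
  rw [← coeff_zero_eq_constantCoeff_apply, hf j 0 (by simp), coeff_monomial, if_neg]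
  exact fun h => by simpa using congrArg Finsupp.degree h

lemma isLeading (hf : HasDiagonalPart lam f) (j : σ) :
    IsLeading 1 (f j) (monomial (Finsupp.single j 1) (lam j)) := by
  classical
  refine ⟨one_le_order_iff_constCoeff_eq_zero.2 (hf.constantCoeff_eq_zero j), ?_⟩
  ext d
  rw [coeff_homogeneousComponent]
  split_ifs with hd
  · exact hf j d (by omega)
  · rw [coeff_monomial, if_neg]
    rintro rfl
    exact hd (Finsupp.degree_single _ _)

lemma coeff_multiPow (hf : HasDiagonalPart lam f) [DecidableEq σ] {d e : σ →₀ ℕ}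
    (hde : d.degree ≤ e.degree) :
    coeff d (multiPow f e) = if d = e then multiPow lam e else 0 := by
  rw [(IsLeading.multiPow hf.isLeading e).coeff_eq hde, multiPow_monomial, coeff_monomial]

lemma one_update_X [DecidableEq σ] {φ : MvPowerSeries σ K} {i : σ}
    (hφ : ∀ d : σ →₀ ℕ, d.degree < 2 → coeff d φ = coeff d (X i)) :
    HasDiagonalPart 1 (Function.update X i φ) := by
  intro j d hd
  by_cases hj : j = i
  · rw [hj, Function.update_self, hφ d hd, X, Pi.one_apply]
  · rw [Function.update_of_ne hj, X, Pi.one_apply]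

variable [Finite σ]

lemma hasSubst (hf : HasDiagonalPart lam f) : HasSubst f :=
  hasSubst_of_constantCoeff_zero hf.constantCoeff_eq_zero

lemma coeff_subst (hf : HasDiagonalPart lam f) (s : MvPowerSeries σ K) (d : σ →₀ ℕ) :
    coeff d (subst f s) = multiPow lam d * coeff d s +
      ∑ e ∈ indicesBelow σ d.degree, coeff e s * coeff d (multiPow f e) := by
  classical
  have hsupp : (Function.support fun e => coeff e s • coeff d (multiPow f e)) ⊆
      (insert d (indicesBelow σ d.degree) : Finset (σ →₀ ℕ)) := by
    intro e he
    by_contra h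
    simp only [Finset.coe_insert, Set.mem_insert_iff, Finset.mem_coe, mem_indicesBelow, not_or,
      not_lt] at h
    exact he (by simp only [hf.coeff_multiPow h.2, if_neg (Ne.symm h.1), smul_zero])
  have hd : d ∉ indicesBelow σ d.degree := by simp [mem_indicesBelow]
  calc coeff d (subst f s) = ∑ᶠ e, coeff e s • coeff d (multiPow f e) :=
        MvPowerSeries.coeff_subst hf.hasSubst s d
    _ = _ := by
        rw [finsum_eq_sum_of_support_subset _ hsupp, Finset.sum_insert hd]
        simp only [smul_eq_mul, hf.coeff_multiPow le_rfl, if_pos, mul_comm (multiPow lam d)]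

lemma coeff_subst_of_le_order (hf : HasDiagonalPart lam f) {s : MvPowerSeries σ K} {d : σ →₀ ℕ}
    (hd : (d.degree : ℕ∞) ≤ s.order) : coeff d (subst f s) = multiPow lam d * coeff d s := by
  rw [hf.coeff_subst, Finset.sum_eq_zero, add_zero]
  intro e he
  rw [natCast_le_order_iff.1 hd e (mem_indicesBelow.1 he), zero_mul]

end HasDiagonalPart

lemma exists_coeff_eq_of_recursion {σ R : Type*} [Semiring R]
    (step : (σ →₀ ℕ) → ((σ →₀ ℕ) → R) → R)
    (hstep : ∀ d c c', (∀ e : σ →₀ ℕ, e.degree < d.degree → c e = c' e) →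
      step d c = step d c') :
    ∃ s : MvPowerSeries σ R, ∀ d, coeff d s = step d fun e => coeff e s := by
  classical
  have wf : WellFounded fun e d : σ →₀ ℕ => e.degree < d.degree :=
    (measure fun d : σ →₀ ℕ => d.degree).wf
  let c : (σ →₀ ℕ) → R := wf.fix fun d rec =>
    step d fun e => if h : e.degree < d.degree then rec e h else 0
  have hc (d : σ →₀ ℕ) : c d = step d fun e => if e.degree < d.degree then c e else 0 :=
    wf.fix_eq _ d
  exact ⟨c, fun d => (hc d).trans (hstep _ _ _ fun e he => if_pos he)⟩

namespace HasDiagonalPart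

variable {σ K : Type*} [Finite σ] [Field K] {lam : σ → K} {f : σ → MvPowerSeries σ K}

/-- The homological equation `φ ∘ f - μ φ = t` can be solved away from the resonances
`lam ^ d = μ`, where the coefficients of `φ` are free. -/
lemma exists_coeff_subst_sub_smul_eq (hf : HasDiagonalPart lam f) (μ : K)
    (s t : MvPowerSeries σ K) :
    ∃ φ : MvPowerSeries σ K, (∀ d, multiPow lam d = μ → coeff d φ = coeff d s) ∧
      ∀ d, multiPow lam d ≠ μ → coeff d (subst f φ - μ • φ) = coeff d t := by
  classical
  obtain ⟨φ, hφ⟩ := exists_coeff_eq_of_recursion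
    (fun d c => if multiPow lam d = μ then coeff d s else (multiPow lam d - μ)⁻¹ *
      (coeff d t - ∑ e ∈ indicesBelow σ d.degree, c e * coeff d (multiPow f e))) (by
    intro d c c' h
    congr 3
    exact Finset.sum_congr rfl fun e he => by rw [h e (mem_indicesBelow.1 he)])
  refine ⟨φ, fun d hd => by rw [hφ d, if_pos hd], fun d hd => ?_⟩
  have hφd := hφ d
  rw [if_neg hd, eq_inv_mul_iff_mul_eq₀ (sub_ne_zero.2 hd)] at hφd
  rw [map_sub, hf.coeff_subst, coeff_smul]
  linear_combination hφd

lemma exists_subst_eq (hf : HasDiagonalPart 1 f) (t : MvPowerSeries σ K) :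
    ∃ s : MvPowerSeries σ K, subst f s = t := by
  obtain ⟨s, -, hs⟩ := hf.exists_coeff_subst_sub_smul_eq 0 0 t
  exact ⟨s, ext fun d => by simpa using hs d (by simp)⟩

lemma exists_normalisation (hf : HasDiagonalPart lam f) (i : σ) :
    ∃ φ : MvPowerSeries σ K, (∀ d : σ →₀ ℕ, d.degree < 2 → coeff d φ = coeff d (X i)) ∧
      ∀ d : σ →₀ ℕ, ¬ (2 ≤ d.degree ∧ lam i = multiPow lam d) →
        coeff d (subst f φ - lam i • φ) = 0 := by
  classical
  obtain ⟨φ, hres, hnonres⟩ := hf.exists_coeff_subst_sub_smul_eq (lam i) (X i) 0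
  have hsub {d : σ →₀ ℕ} (hd : (d.degree : ℕ∞) ≤ φ.order) :
      coeff d (subst f φ - lam i • φ) = (multiPow lam d - lam i) * coeff d φ := by
    rw [map_sub, coeff_smul, hf.coeff_subst_of_le_order hd, sub_mul]
  have hlow {d : σ →₀ ℕ} (hd : (d.degree : ℕ∞) ≤ φ.order) : coeff d φ = coeff d (X i) := by
    by_cases hdi : multiPow lam d = lam i
    · exact hres d hdi
    have hφd : coeff d φ = 0 := by simpa [hsub hd, sub_eq_zero, hdi] using hnonres d hdi
    rw [hφd, coeff_X, if_neg]
    rintro rfl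
    exact hdi (by simp)
  have horder : ((1 : ℕ) : ℕ∞) ≤ φ.order := natCast_le_order_iff.2 fun d hd => by
    rw [(Finsupp.degree_eq_zero_iff d).1 (by omega), hlow (by simp), coeff_zero_X]
  have hle {d : σ →₀ ℕ} (hd : d.degree < 2) : (d.degree : ℕ∞) ≤ φ.order :=
    le_trans (by exact_mod_cast Nat.le_of_lt_succ hd) horder
  refine ⟨φ, fun d hd => hlow (hle hd), fun d hd => ?_⟩
  by_cases hdi : multiPow lam d = lam i
  · rw [hsub (hle (by by_contra! h; exact hd ⟨h, hdi.symm⟩)), hdi, sub_self, zero_mul]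
  · simpa using hnonres d hdi

end HasDiagonalPart

lemma IsFormalDiff.of_hasDiagonalPart_one {n : ℕ} {Φ : Fin n → MvPowerSeries (Fin n) ℂ}
    (hΦ : HasDiagonalPart 1 Φ) : IsFormalDiff Φ := by
  refine ⟨hΦ.constantCoeff_eq_zero, ?_⟩
  convert isUnit_one
  ext i j
  simp [hΦ i _ (show (Finsupp.single j 1).degree < 2 by simp), coeff_monomial, Matrix.one_apply,
    Finsupp.single_left_inj, eq_comm]

variable {n : ℕ} {F : (Fin n → ℂ) → (Fin n → ℂ)} {lam : Fin n → ℂ}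
  {f : Fin n → MvPowerSeries (Fin n) ℂ}

lemma HasTaylorSeries.exists_formallyConjugate (hFf : HasTaylorSeries F f)
    {Φ : Fin n → MvPowerSeries (Fin n) ℂ} (hΦ : HasDiagonalPart 1 Φ) :
    ∃ G, FormallyConjugate F G ∧ ∀ j, subst f (Φ j) = subst Φ (G j) := by
  choose G hG using fun j => hΦ.exists_subst_eq (subst f (Φ j))
  exact ⟨G, ⟨f, Φ, hFf, .of_hasDiagonalPart_one hΦ, fun j => (hG j).symm⟩, fun j => (hG j).symm⟩

lemma HasTaylorSeries.exists_resonant_leading_terms (hFf : HasTaylorSeries F f)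
    (hf : HasDiagonalPart lam f) (i : Fin n) :
    ∃ G, FormallyConjugate F G ∧ ∀ d : Fin n →₀ ℕ,
      (d.degree : ℕ∞) ≤ (G i - monomial (Finsupp.single i 1) (lam i)).order →
      coeff d (G i - monomial (Finsupp.single i 1) (lam i)) ≠ 0 → IsResonance lam i d := by
  classical
  obtain ⟨φ, hφ, hres⟩ := hf.exists_normalisation i
  have hΦ := HasDiagonalPart.one_update_X hφ
  obtain ⟨G, hFG, hG⟩ := hFf.exists_formallyConjugate hΦ
  refine ⟨G, hFG, fun d hd => not_imp_comm.1 fun hdres => ?_⟩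
  have hsubst : subst (Function.update X i φ) (G i - monomial (Finsupp.single i 1) (lam i)) =
      subst f φ - lam i • φ := by
    rw [subst_sub hΦ.hasSubst, ← hG i, subst_monomial hΦ.hasSubst]
    simp [Algebra.smul_def]
  have hcoeff := hΦ.coeff_subst_of_le_order hd
  rwa [hsubst, hres d hdres, one_multiPow, one_mul, eq_comm] at hcoeff

variable [NeZero n] {α : Fin n →₀ ℕ}

lemma eq_zero_of_val_lt_one {j : Fin n} (hj : j.val < 1) : j = 0 :=
  Fin.ext (by simpa using hj)

lemma IsOneResonant.formallyLinearizable_or_hasResonantForm (hα : IsOneResonant lam 1 α)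
    (hFf : HasTaylorSeries F f) (hf : HasDiagonalPart lam f) :
    FormallyLinearizable F lam 1 ∨ ∃ k, HasResonantForm F lam 1 α k := by
  classical
  obtain ⟨G, hFG, hG⟩ := hFf.exists_resonant_leading_terms hf 0
  set r := G 0 - monomial (Finsupp.single 0 1) (lam 0) with hr
  have hGr : G 0 = monomial (Finsupp.single 0 1) (lam 0) + r := by rw [hr, add_sub_cancel]
  have hres (e : Fin n →₀ ℕ) (he : (e.degree : ℕ∞) ≤ r.order) (her : coeff e r ≠ 0) :=
    (hα.2.2 0 zero_lt_one e).1 (hG e he her)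
  have hdeg (k : ℕ) : (k • α + Finsupp.single 0 1).degree = α.degree * k + 1 := by
    simp [mul_comm]
  by_cases hr0 : r = 0
  · exact .inl ⟨G, hFG, fun j hj => by rw [eq_zero_of_val_lt_one hj, hGr, hr0, add_zero]⟩
  obtain ⟨d, hd, hdr⟩ := exists_coeff_ne_zero_and_order (ne_zero_iff_order_finite.1 hr0)
  obtain ⟨k, hk, rfl⟩ := hres d hdr.le hd
  refine .inr ⟨k, hk, G, hFG, fun _ => coeff (k • α + Finsupp.single 0 1) r,
    ⟨0, zero_lt_one, hd⟩, fun j hj e he => ?_⟩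
  rw [eq_zero_of_val_lt_one hj, hGr, map_add, map_add, coeff_monomial e (k • α + _)]
  congr 1
  split_ifs with hek
  · rw [hek]
  by_contra her
  have hle : e.degree ≤ (k • α + Finsupp.single 0 1).degree := by rw [hdeg]; omega
  obtain ⟨k', -, rfl⟩ := hres e (hdr ▸ by exact_mod_cast hle) her
  have hge : (k • α + Finsupp.single 0 1).degree ≤ (k' • α + Finsupp.single 0 1).degree := by
    exact_mod_cast hdr.le.trans (order_le her)
  rw [hdeg, hdeg] at hle hge
  have hα0 : α.degree ≠ 0 := mt (Finsupp.degree_eq_zero_iff α).1 hα.1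
  have hk' : k' = k := Nat.eq_of_mul_eq_mul_left (Nat.pos_of_ne_zero hα0) (by omega)
  exact hek (by rw [hk'])

end FormalSeries

section TaylorSeries

variable {ι 𝕜 : Type*} [NontriviallyNormedField 𝕜]

lemma norm_multiPow_le [Fintype ι] (z : ι → 𝕜) (d : ι →₀ ℕ) : ‖multiPow z d‖ ≤ ‖z‖ ^ d.degree := by
  rw [multiPow, Finsupp.prod_fintype _ _ (by simp), norm_prod, Finsupp.degree_eq_sum,
    ← Finset.prod_pow_eq_pow_sum]
  exact Finset.prod_le_prod (fun _ _ => norm_nonneg _) fun i _ => by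
    rw [norm_pow]
    gcongr
    exact norm_le_pi_norm z i

/-- The multi-index counting the letters of a finite word. -/
noncomputable def wordIndex (x : Σ m : ℕ, Fin m → ι) : ι →₀ ℕ :=
  ∑ l, Finsupp.single (x.2 l) 1

lemma degree_wordIndex (x : Σ m : ℕ, Fin m → ι) : (wordIndex x).degree = x.1 := by
  simp [wordIndex]

lemma multiPow_wordIndex {M : Type*} [CommMonoid M] (z : ι → M) (x : Σ m : ℕ, Fin m → ι) :
    multiPow z (wordIndex x) = ∏ l, z (x.2 l) := by
  rw [multiPow, wordIndex, ← Finsupp.prod_finsetSum_index (by simp) (by simp [pow_add])]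
  simp

lemma finite_wordIndex_fiber [Finite ι] (d : ι →₀ ℕ) :
    Finite {x : Σ m : ℕ, Fin m → ι // wordIndex x = d} := by
  refine Set.Finite.subset (Set.finite_range fun w : Fin d.degree → ι =>
    (⟨d.degree, w⟩ : Σ m : ℕ, Fin m → ι)) ?_
  rintro ⟨m, w⟩ (hx : wordIndex _ = d)
  obtain rfl : m = d.degree := by rw [← hx, degree_wordIndex]
  exact ⟨w, rfl⟩

variable [DecidableEq ι] {p : FormalMultilinearSeries 𝕜 (ι → 𝕜) 𝕜} {z : ι → 𝕜}

/-- The value of a formal multilinear series at the tuple of basis vectors spelled by a word. -/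
noncomputable def wordCoeff (p : FormalMultilinearSeries 𝕜 (ι → 𝕜) 𝕜)
    (x : Σ m : ℕ, Fin m → ι) : 𝕜 :=
  p x.1 fun l => Pi.single (x.2 l) 1

/-- The power series obtained from a formal multilinear series by collecting the words with a given
multi-index. -/
noncomputable def collectWords (p : FormalMultilinearSeries 𝕜 (ι → 𝕜) 𝕜) : MvPowerSeries ι 𝕜 :=
  fun d => ∑' x : {x : Σ m : ℕ, Fin m → ι // wordIndex x = d}, wordCoeff p x

lemma hasSum_coeff_collectWords [Finite ι] {a : 𝕜}
    (h : HasSum (fun x => wordCoeff p x * multiPow z (wordIndex x)) a) :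
    HasSum (fun d => MvPowerSeries.coeff d (collectWords p) * multiPow z d) a := by
  refine ((Equiv.sigmaFiberEquiv wordIndex).hasSum_iff.2 h).sigma fun d => ?_
  have := finite_wordIndex_fiber d
  have hd : HasSum (fun x : {x // wordIndex x = d} => wordCoeff p x * multiPow z d)
      (MvPowerSeries.coeff d (collectWords p) * multiPow z d) :=
    Summable.of_finite.hasSum.mul_right _
  convert hd using 2 with x
  rw [Function.comp_apply, Equiv.sigmaFiberEquiv_apply, x.2]

variable [Fintype ι]

lemma norm_wordCoeff_le (p : FormalMultilinearSeries 𝕜 (ι → 𝕜) 𝕜) (x : Σ m : ℕ, Fin m → ι) :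
    ‖wordCoeff p x‖ ≤ ‖p x.1‖ :=
  (p x.1).unit_le_opNorm <| (pi_norm_le_iff_of_nonneg zero_le_one).2 fun _ =>
    (Pi.norm_single _).trans_le norm_one.le

lemma apply_diagonal_eq_sum_wordCoeff (p : FormalMultilinearSeries 𝕜 (ι → 𝕜) 𝕜) (m : ℕ)
    (z : ι → 𝕜) :
    p m (fun _ => z) =
      ∑ w : Fin m → ι, wordCoeff p ⟨m, w⟩ * multiPow z (wordIndex ⟨m, w⟩) := by
  conv_lhs => rw [pi_eq_sum_univ' z, (p m).map_sum fun _ i => z i • (Pi.single i 1 : ι → 𝕜)]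
  refine Finset.sum_congr rfl fun w _ => ?_
  rw [(p m).map_smul_univ, multiPow_wordIndex, smul_eq_mul, mul_comm, wordCoeff]

lemma summable_wordCoeff_mul_multiPow [CompleteSpace 𝕜]
    (h : Summable fun m => ‖p m‖ * (Fintype.card ι * ‖z‖) ^ m) :
    Summable fun x => wordCoeff p x * multiPow z (wordIndex x) := by
  have hterm (m : ℕ) (w : Fin m → ι) :
      ‖wordCoeff p ⟨m, w⟩ * multiPow z (wordIndex ⟨m, w⟩)‖ ≤ ‖p m‖ * ‖z‖ ^ m := by
    rw [norm_mul]
    gcongr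
    · exact norm_wordCoeff_le p ⟨m, w⟩
    · simpa only [degree_wordIndex] using norm_multiPow_le z (wordIndex ⟨m, w⟩)
  refine .of_norm ((summable_sigma_of_nonneg fun _ => norm_nonneg _).2
    ⟨fun m => .of_finite, h.of_nonneg_of_le (fun m => tsum_nonneg fun _ => norm_nonneg _)
      fun m => ?_⟩)
  rw [tsum_fintype]
  refine (Finset.sum_le_card_nsmul _ _ _ fun w _ => hterm m w).trans_eq ?_
  rw [Finset.card_univ, Fintype.card_fun, Fintype.card_fin, nsmul_eq_mul, Nat.cast_pow, mul_pow,
    mul_left_comm]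

lemma eventually_hasSum_coeff_collectWords [CompleteSpace 𝕜] {H : (ι → 𝕜) → 𝕜}
    (hp : HasFPowerSeriesAt H p 0) :
    ∀ᶠ z in 𝓝 0, HasSum (fun d => MvPowerSeries.coeff d (collectWords p) * multiPow z d) (H z) := by
  obtain ⟨r, hp⟩ := hp
  obtain ⟨r', hr'0, hr'⟩ := ENNReal.lt_iff_exists_nnreal_btwn.1 hp.r_pos
  have hsmall : ∀ᶠ z : ι → 𝕜 in 𝓝 0, Fintype.card ι * ‖z‖ < r' := by
    refine (continuous_const.mul continuous_norm).tendsto' _ 0 (by simp) |>.eventually_lt_const ?_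
    exact_mod_cast hr'0
  filter_upwards [hsmall, Metric.eball_mem_nhds _ hp.r_pos] with z hz hzr
  have hsum : Summable fun m => ‖p m‖ * (Fintype.card ι * ‖z‖) ^ m :=
    (p.summable_norm_mul_pow (hr'.trans_le hp.r_le)).of_nonneg_of_le (fun m => by positivity)
      fun m => by gcongr
  refine hasSum_coeff_collectWords ?_
  have hHz := hp.hasSum hzr
  rw [zero_add] at hHz
  refine HasSum.sigma_of_hasSum hHz (fun m => ?_) (summable_wordCoeff_mul_multiPow hsum)
  rw [apply_diagonal_eq_sum_wordCoeff]
  exact hasSum_fintype _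

lemma exists_hasTaylorSeries {n : ℕ} {F : (Fin n → ℂ) → (Fin n → ℂ)} (hF : AnalyticAt ℂ F 0) :
    ∃ f, HasTaylorSeries F f := by
  choose p hp using analyticAt_pi_iff.1 hF
  exact ⟨fun j => collectWords (p j),
    eventually_all.2 fun j => eventually_hasSum_coeff_collectWords (hp j)⟩

end TaylorSeries

section Jets

open Asymptotics MvPowerSeries

variable {ι 𝕜 : Type*} [NontriviallyNormedField 𝕜]

lemma eval_eq_sum_multiPow {R : Type*} [CommSemiring R] (P : MvPolynomial ι R) (z : ι → R) :
    MvPolynomial.eval z P = ∑ d ∈ P.support, P.coeff d * multiPow z d := by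
  rw [MvPolynomial.eval_eq]
  refine Finset.sum_congr rfl fun d _ => ?_
  rw [multiPow, Finsupp.prod]

lemma multiPow_const {M : Type*} [CommMonoid M] (x : M) (d : ι →₀ ℕ) :
    multiPow (fun _ => x) d = x ^ d.degree := by
  induction d using Finsupp.induction_linear with
  | zero => simp
  | add a b ha hb => rw [multiPow_add, ha, hb, map_add, pow_add]
  | single j m => simp

lemma isBigO_eval_one (P : MvPolynomial ι 𝕜) :
    (fun z => MvPolynomial.eval z P) =O[𝓝 0] fun _ : ι → 𝕜 => (1 : ℝ) :=
  (MvPolynomial.continuous_eval P).continuousAt.isBigO_one ℝ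

variable [Fintype ι]

/-- The function `H` agrees with the power series `s` at `0` up to an error `O(‖z‖ ^ N)`. -/
def IsJet (N : ℕ) (H : (ι → 𝕜) → 𝕜) (s : MvPowerSeries ι 𝕜) : Prop :=
  ∃ P : MvPolynomial ι 𝕜, (N : ℕ∞) ≤ (s - P).order ∧
    (fun z => H z - MvPolynomial.eval z P) =O[𝓝 0] fun z => ‖z‖ ^ N

lemma isBigO_eval_of_le_order {P : MvPolynomial ι 𝕜} {N : ℕ}
    (hP : (N : ℕ∞) ≤ (P : MvPowerSeries ι 𝕜).order) :
    (fun z => MvPolynomial.eval z P) =O[𝓝 0] fun z : ι → 𝕜 => ‖z‖ ^ N := by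
  simp only [eval_eq_sum_multiPow]
  refine IsBigO.fun_sum fun d hd => ?_
  have hdN : N ≤ d.degree := by
    by_contra! h
    have := natCast_le_order_iff.1 hP d h
    rw [MvPolynomial.coeff_coe] at this
    exact (MvPolynomial.mem_support_iff.1 hd) this
  refine IsBigO.of_bound ‖P.coeff d‖ ?_
  filter_upwards [Metric.ball_mem_nhds (0 : ι → 𝕜) one_pos] with z hz
  rw [norm_mul, norm_pow, norm_norm]
  gcongr
  refine (norm_multiPow_le z d).trans (pow_le_pow_of_le_one (norm_nonneg _) ?_ hdN)
  exact (mem_ball_zero_iff.1 hz).le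

lemma isBigO_pow_norm_one (N : ℕ) :
    (fun z : ι → 𝕜 => ‖z‖ ^ N) =O[𝓝 0] fun _ : ι → 𝕜 => (1 : ℝ) :=
  (continuous_norm.pow N).continuousAt.isBigO_one ℝ

lemma isJet_eval (N : ℕ) (P : MvPolynomial ι 𝕜) :
    IsJet N (fun z => MvPolynomial.eval z P) P :=
  ⟨P, by simp, by simpa using isBigO_zero _ _⟩

lemma IsJet.isBigO_sub {N : ℕ} {H : (ι → 𝕜) → 𝕜} {s : MvPowerSeries ι 𝕜}
    (h : IsJet N H s) {P : MvPolynomial ι 𝕜} (hP : (N : ℕ∞) ≤ (s - P).order) :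
    (fun z => H z - MvPolynomial.eval z P) =O[𝓝 0] fun z => ‖z‖ ^ N := by
  obtain ⟨Q, hQ, hH⟩ := h
  have : (N : ℕ∞) ≤ ((Q - P : MvPolynomial ι 𝕜) : MvPowerSeries ι 𝕜).order := by
    rw [show ((Q - P : MvPolynomial ι 𝕜) : MvPowerSeries ι 𝕜) = Q - P from
      map_sub MvPolynomial.coeToMvPowerSeries.ringHom Q P, ← sub_sub_sub_cancel_left _ _ s]
    exact le_order_sub hP hQ
  refine (hH.add (isBigO_eval_of_le_order this)).congr_left fun z => ?_
  rw [map_sub]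
  ring

lemma IsJet.add {N : ℕ} {H K : (ι → 𝕜) → 𝕜} {s t : MvPowerSeries ι 𝕜}
    (hH : IsJet N H s) (hK : IsJet N K t) : IsJet N (fun z => H z + K z) (s + t) := by
  obtain ⟨P, hP, hHP⟩ := hH
  obtain ⟨Q, hQ, hKQ⟩ := hK
  refine ⟨P + Q, ?_, ?_⟩
  · rw [MvPolynomial.coe_add, add_sub_add_comm]
    exact le_order_add hP hQ
  · refine (hHP.add hKQ).congr_left fun z => ?_
    rw [map_add]
    ring

lemma IsJet.isBigO_one {N : ℕ} {H : (ι → 𝕜) → 𝕜} {s : MvPowerSeries ι 𝕜}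
    (hH : IsJet N H s) : H =O[𝓝 0] fun _ => (1 : ℝ) := by
  obtain ⟨P, -, hHP⟩ := hH
  refine ((hHP.trans (isBigO_pow_norm_one N)).add (isBigO_eval_one P)).congr_left fun z => ?_
  ring

lemma IsJet.mul {N : ℕ} {H K : (ι → 𝕜) → 𝕜} {s t : MvPowerSeries ι 𝕜}
    (hH : IsJet N H s) (hK : IsJet N K t) : IsJet N (fun z => H z * K z) (s * t) := by
  have hH1 := hH.isBigO_one
  obtain ⟨P, hP, hHP⟩ := hH
  obtain ⟨Q, hQ, hKQ⟩ := hK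
  refine ⟨P * Q, ?_, ?_⟩
  · rw [MvPolynomial.coe_mul, show s * t - P * Q = (t - Q) * s + (s - P) * Q by ring]
    exact le_order_add (le_order_mul_of_left _ hQ) (le_order_mul_of_left _ hP)
  · have h1 := hH1.mul hKQ
    have h2 := hHP.mul (isBigO_eval_one Q)
    simp only [one_mul] at h1
    simp only [mul_one] at h2
    refine (h1.add h2).congr_left fun z => ?_
    rw [map_mul]
    ring

lemma IsJet.eval_comp {N : ℕ} {F : (ι → 𝕜) → (ι → 𝕜)}
    {f : ι → MvPowerSeries ι 𝕜} (hF : ∀ j, IsJet N (fun z => F z j) (f j))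
    (P : MvPolynomial ι 𝕜) :
    IsJet N (fun z => MvPolynomial.eval (F z) P) (MvPolynomial.aeval f P) := by
  induction P using MvPolynomial.induction_on with
  | C a => simpa [MvPowerSeries.algebraMap_apply] using isJet_eval N (MvPolynomial.C a)
  | add p q hp hq => simpa using hp.add hq
  | mul_X p i hp => simpa using hp.mul (hF i)

lemma norm_sub_eval_truncTotal_le {s : MvPowerSeries ι 𝕜} {r : ℝ} (hr : 0 < r)
    (hsum : Summable fun d => ‖coeff d s‖ * r ^ d.degree) {z : ι → 𝕜} (hz : ‖z‖ ≤ r) {a : 𝕜}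
    (ha : HasSum (fun d => coeff d s * multiPow z d) a) (N : ℕ) :
    ‖a - MvPolynomial.eval z (truncTotal N s)‖ ≤
      (∑' d, ‖coeff d s‖ * r ^ d.degree / r ^ N) * ‖z‖ ^ N := by
  have heval : HasSum (fun d => (truncTotal N s).coeff d * multiPow z d)
      (MvPolynomial.eval z (truncTotal N s)) := by
    rw [eval_eq_sum_multiPow]
    refine hasSum_sum_of_ne_finset_zero fun d hd => ?_
    rw [MvPolynomial.notMem_support_iff.1 hd, zero_mul]
  refine (ha.sub heval).norm_le_of_bounded ((hsum.div_const _).hasSum.mul_right _) fun d => ?_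
  rw [← sub_mul, norm_mul]
  rcases lt_or_ge d.degree N with hd | hd
  · rw [coeff_truncTotal s hd, sub_self, norm_zero, zero_mul]
    positivity
  · rw [coeff_truncTotal_eq_zero s hd, sub_zero, mul_div_assoc, mul_assoc]
    gcongr
    refine (norm_multiPow_le z d).trans ?_
    obtain ⟨m, hm⟩ := Nat.exists_eq_add_of_le hd
    rw [hm, pow_add, pow_add, mul_div_cancel_left₀ _ (by positivity), mul_comm]
    gcongr

lemma isJet_of_eventually_hasSum {𝕜 : Type*} [RCLike 𝕜] {H : (ι → 𝕜) → 𝕜} {s : MvPowerSeries ι 𝕜}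
    (hs : ∀ᶠ z in 𝓝 0, HasSum (fun d => coeff d s * multiPow z d) (H z)) (N : ℕ) :
    IsJet N H s := by
  have horder : (N : ℕ∞) ≤ (s - (truncTotal N s : MvPolynomial ι 𝕜)).order :=
    natCast_le_order_iff.2 fun d hd => by
      rw [map_sub, MvPolynomial.coeff_coe, coeff_truncTotal s hd, sub_self]
  obtain ⟨ε, hε, hball⟩ := Metric.eventually_nhds_iff.1 hs
  obtain ⟨x, hx0, hxε⟩ := NormedField.exists_norm_lt 𝕜 hε
  have hsum : Summable fun d => ‖coeff d s‖ * ‖x‖ ^ d.degree := by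
    have hx : dist (fun _ => x) (0 : ι → 𝕜) < ε := by
      rw [dist_zero_right]
      exact (pi_norm_const_le x).trans_lt hxε
    simpa only [norm_mul, multiPow_const, norm_pow] using (hball hx).summable.norm
  refine ⟨truncTotal N s, horder, .of_bound (∑' d, ‖coeff d s‖ * ‖x‖ ^ d.degree / ‖x‖ ^ N) ?_⟩
  filter_upwards [Metric.ball_mem_nhds 0 hx0] with z hz
  rw [mem_ball_zero_iff] at hz
  rw [norm_pow, norm_norm]
  exact norm_sub_eval_truncTotal_le hx0 hsum hz.le
    (hball (by rw [dist_zero_right]; exact hz.trans hxε)) N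

/-- The differential at `0` determined by the linear coefficients of a power series. -/
noncomputable def linearPart (s : MvPowerSeries ι 𝕜) : (ι → 𝕜) →L[𝕜] 𝕜 :=
  ∑ i, coeff (Finsupp.single i 1) s • (ContinuousLinearMap.proj i : (ι → 𝕜) →L[𝕜] 𝕜)

lemma linearPart_apply (s : MvPowerSeries ι 𝕜) (v : ι → 𝕜) :
    linearPart s v = ∑ i, coeff (Finsupp.single i 1) s * v i := by
  simp [linearPart]

lemma linearPart_single [DecidableEq ι] (s : MvPowerSeries ι 𝕜) (i : ι) :
    linearPart s (Pi.single i 1) = coeff (Finsupp.single i 1) s := by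
  simp [linearPart_apply, Pi.single_apply]

lemma exists_eval_eq_add_linearPart (s : MvPowerSeries ι 𝕜) :
    ∃ P : MvPolynomial ι 𝕜, ((2 : ℕ) : ℕ∞) ≤ (s - P).order ∧
      ∀ z, MvPolynomial.eval z P = constantCoeff s + linearPart s z := by
  classical
  refine ⟨MvPolynomial.C (constantCoeff s) +
    ∑ i, MvPolynomial.C (coeff (Finsupp.single i 1) s) * MvPolynomial.X i,
    natCast_le_order_iff.2 fun d hd => ?_, fun z => by simp [linearPart_apply]⟩
  rw [map_sub, MvPolynomial.coeff_coe, sub_eq_zero]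
  obtain rfl | ⟨i, rfl⟩ := eq_zero_or_eq_single_of_degree_lt_two hd
  · simp [MvPolynomial.coeff_sum, MvPolynomial.coeff_C_mul]
  · have h0 : (0 : ι →₀ ℕ) ≠ Finsupp.single i 1 := (Finsupp.single_ne_zero.2 one_ne_zero).symm
    simp [MvPolynomial.coeff_sum, MvPolynomial.coeff_C_mul, MvPolynomial.coeff_C,
      MvPolynomial.coeff_X, h0, Finsupp.single_left_inj]

lemma IsJet.apply_zero_and_hasFDerivAt {H : (ι → 𝕜) → 𝕜} {s : MvPowerSeries ι 𝕜}
    (h : IsJet 2 H s) : H 0 = constantCoeff s ∧ HasFDerivAt H (linearPart s) 0 := by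
  obtain ⟨P, hP, heval⟩ := exists_eval_eq_add_linearPart s
  have hO : (fun z => H z - MvPolynomial.eval z P) =O[𝓝 0] fun z => ‖z - 0‖ ^ 2 := by
    simpa only [sub_zero] using h.isBigO_sub hP
  constructor
  · have h0 := hO.eq_zero_of_norm_pow two_ne_zero
    rwa [heval, map_zero, add_zero, sub_eq_zero] at h0
  · have hPd : HasFDerivAt (fun z => MvPolynomial.eval z P) (linearPart s) 0 := by
      simp only [heval]
      exact (linearPart s).hasFDerivAt.const_add _
    simpa using (hO.hasFDerivAt (𝕜 := 𝕜) one_lt_two).fun_add hPd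

end Jets

section Semiconjugacy

open Asymptotics MvPowerSeries

/-- `h` is an analytic function with `h 0 = 0` and non-zero differential at `0`, usable as a
coordinate, which `F` transforms by `t ↦ μ * t + a * t ^ m` up to an error of order `N` at `0`. -/
structure IsSemiconjugacy {𝕜 E : Type*} [NontriviallyNormedField 𝕜] [NormedAddCommGroup E]
    [NormedSpace 𝕜 E] (F : E → E) (μ a : 𝕜) (m N : ℕ) (h : E → 𝕜) : Prop where
  analyticAt : AnalyticAt 𝕜 h 0
  map_zero : h 0 = 0
  fderiv_ne_zero : fderiv 𝕜 h 0 ≠ 0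
  isBigO : (fun z => h (F z) - (μ * h z + a * h z ^ m)) =O[𝓝 0] fun z => ‖z‖ ^ N

lemma le_order_subst_sub {σ R : Type*} [Finite σ] [CommRing R] {f Φ : σ → MvPowerSeries σ R}
    (hf : ∀ j, constantCoeff (f j) = 0) (hΦ : ∀ j, constantCoeff (Φ j) = 0)
    {g p : MvPowerSeries σ R} {j : σ} {μ a : R} {m : ℕ} {N : ℕ∞}
    (hconj : subst f (Φ j) = subst Φ g) (hp : N ≤ (Φ j - p).order)
    (hg : N ≤ (g - (monomial (Finsupp.single j 1) μ + monomial (Finsupp.single j m) a)).order) :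
    N ≤ (subst f p - (algebraMap R _ μ * p + algebraMap R _ a * p ^ m)).order := by
  have hfs := hasSubst_of_constantCoeff_zero hf
  have hΦs := hasSubst_of_constantCoeff_zero hΦ
  have h₁ := le_order_subst hf hp
  have h₂ := le_order_subst hΦ hg
  rw [subst_sub hfs, hconj] at h₁
  rw [subst_sub hΦs, subst_add hΦs, subst_monomial hΦs, subst_monomial hΦs,
    Finsupp.prod_single_index (by simp), Finsupp.prod_single_index (by simp), pow_one] at h₂
  obtain ⟨c, hc⟩ := sub_dvd_pow_sub_pow (Φ j) p m
  have hsplit : subst f p - (algebraMap R _ μ * p + algebraMap R _ a * p ^ m) =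
      subst Φ g - (algebraMap R _ μ * Φ j + algebraMap R _ a * Φ j ^ m) -
        (subst Φ g - subst f p) + (Φ j - p) * (algebraMap R _ μ + algebraMap R _ a * c) := by
    linear_combination algebraMap R (MvPowerSeries σ R) a * hc
  rw [hsplit]
  exact le_order_add (le_order_sub h₂ h₁) (le_order_mul_of_left _ hp)

variable {n : ℕ} {F : (Fin n → ℂ) → (Fin n → ℂ)} {f : Fin n → MvPowerSeries (Fin n) ℂ}
  {lam : Fin n → ℂ}

lemma IsFormalDiff.exists_coeff_single_ne_zero (hf : IsFormalDiff f) (j : Fin n) :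
    ∃ i, coeff (Finsupp.single i 1) (f j) ≠ 0 := by
  by_contra! hrow
  refine ((Matrix.isUnit_iff_isUnit_det _).1 hf.2).ne_zero ?_
  exact Matrix.det_eq_zero_of_row_eq_zero j hrow

lemma HasTaylorSeries.isJet (h : HasTaylorSeries F f) (N : ℕ) (j : Fin n) :
    IsJet N (fun z => F z j) (f j) :=
  isJet_of_eventually_hasSum (h.mono fun _ hz => hz j) N

lemma HasTaylorSeries.hasDiagonalPart (h : HasTaylorSeries F f) (hF0 : F 0 = 0)
    (hF : DifferentiableAt ℂ F 0) (hdiag : ∀ v j, fderiv ℂ F 0 v j = lam j * v j) :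
    HasDiagonalPart lam f := by
  intro j d hd
  obtain ⟨hconst, hderiv⟩ := (h.isJet 2 j).apply_zero_and_hasFDerivAt
  have hlin := (hasFDerivAt_pi'.1 hF.hasFDerivAt j).unique hderiv
  rw [coeff_monomial]
  obtain rfl | ⟨i, rfl⟩ := eq_zero_or_eq_single_of_degree_lt_two hd
  · rw [if_neg (Finsupp.single_ne_zero.2 one_ne_zero).symm]
    simpa [hF0] using hconst.symm
  · rw [← linearPart_single, ← hlin, ContinuousLinearMap.comp_apply,
      ContinuousLinearMap.proj_apply, hdiag]
    simp [Pi.single_apply, Finsupp.single_left_inj, eq_comm]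

lemma FormallyConjugate.exists_isSemiconjugacy {G : Fin n → MvPowerSeries (Fin n) ℂ}
    (hG : FormallyConjugate F G) (hF0 : F 0 = 0) {μ a : ℂ} {m N : ℕ} (hN : 2 ≤ N) {j : Fin n}
    (hGj : (N : ℕ∞) ≤ (G j - (monomial (Finsupp.single j 1) μ +
      monomial (Finsupp.single j m) a)).order) :
    ∃ h, IsSemiconjugacy F μ a m N h := by
  obtain ⟨f, Φ, hf, hΦ, hconj⟩ := hG
  have hf0 (i : Fin n) : constantCoeff (f i) = 0 := by
    rw [← (hf.isJet 2 i).apply_zero_and_hasFDerivAt.1, hF0, Pi.zero_apply]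
  set P : MvPolynomial (Fin n) ℂ := truncTotal N (Φ j)
  have hP (d : Fin n →₀ ℕ) (hd : d.degree < N) : P.coeff d = coeff d (Φ j) :=
    coeff_truncTotal _ hd
  have hΦP : (N : ℕ∞) ≤ (Φ j - P).order := natCast_le_order_iff.2 fun d hd => by
    rw [map_sub, MvPolynomial.coeff_coe, hP d hd, sub_self]
  obtain ⟨hP0, hP1⟩ := (isJet_eval 2 P).apply_zero_and_hasFDerivAt
  refine ⟨fun z => MvPolynomial.eval z P, AnalyticOnNhd.eval_mvPolynomial P 0 (mem_univ _),
    ?_, fun hzero => ?_, ?_⟩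
  · rw [hP0, ← coeff_zero_eq_constantCoeff_apply, MvPolynomial.coeff_coe,
      hP 0 (by rw [map_zero]; omega), coeff_zero_eq_constantCoeff_apply, hΦ.1]
  · obtain ⟨i, hi⟩ := hΦ.exists_coeff_single_ne_zero j
    rw [hP1.fderiv] at hzero
    rw [← hP _ (by rw [Finsupp.degree_single]; omega), ← MvPolynomial.coeff_coe,
      ← linearPart_single, hzero] at hi
    exact hi rfl
  · set Q : MvPolynomial (Fin n) ℂ := MvPolynomial.C μ * P + MvPolynomial.C a * P ^ m
    have hQ : (Q : MvPowerSeries (Fin n) ℂ) = algebraMap ℂ _ μ * P + algebraMap ℂ _ a * P ^ m := by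
      simp [Q, MvPowerSeries.algebraMap_apply]
    have hFP := (IsJet.eval_comp (hf.isJet N) P).isBigO_sub (P := Q) (by
      rw [← subst_coe, hQ]
      exact le_order_subst_sub hf0 hΦ.1 (hconj j) hΦP hGj)
    simpa only [Q, map_add, map_mul, map_pow, MvPolynomial.eval_C] using hFP

variable [NeZero n]

lemma HasResonantForm.exists_isSemiconjugacy {q k : ℕ}
    (h : HasResonantForm F lam 1 (Finsupp.single 0 q) k) (hF0 : F 0 = 0) :
    ∃ a ≠ 0, ∃ h, IsSemiconjugacy F (lam 0) a (q * k + 1) (q * k + 2) h := by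
  obtain ⟨-, G, hG, a, ⟨j, hj, ha⟩, hcoeff⟩ := h
  obtain rfl := eq_zero_of_val_lt_one hj
  refine ⟨a 0, ha, hG.exists_isSemiconjugacy hF0 (by omega) (j := 0)
    (natCast_le_order_iff.2 fun d hd => ?_)⟩
  rw [map_sub, hcoeff 0 hj d (by simpa using hd), sub_eq_zero,
    Finsupp.smul_single, ← Finsupp.single_add, smul_eq_mul, mul_comm k q]

lemma FormallyLinearizable.exists_isSemiconjugacy (h : FormallyLinearizable F lam 1)
    (hF0 : F 0 = 0) {N : ℕ} (hN : 2 ≤ N) (m : ℕ) :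
    ∃ h, IsSemiconjugacy F (lam 0) 0 m N h := by
  obtain ⟨G, hG, hG0⟩ := h
  refine hG.exists_isSemiconjugacy hF0 hN (j := 0) ?_
  simp [hG0 0 (by simp)]

end Semiconjugacy

section Iterates

open Asymptotics

variable {α 𝕜 E : Type*} [NontriviallyNormedField 𝕜] [NormedAddCommGroup E] [NormedSpace 𝕜 E]

lemma isBigO_pow_sub_pow {l : Filter α} {u v : α → 𝕜} {w w' : α → ℝ} (hu : u =O[l] w)
    (hv : v =O[l] w) (huv : (fun x => u x - v x) =O[l] w') (m : ℕ) :
    (fun x => u x ^ (m + 1) - v x ^ (m + 1)) =O[l] fun x => w x ^ m * w' x := by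
  induction m with
  | zero => simpa using huv
  | succ m ih =>
    have h₁ := (hu.pow (m + 1)).mul huv
    have h₂ := (ih.mul hv).congr_right (g₂ := fun x => w x ^ (m + 1) * w' x) fun x => by ring
    exact (h₁.add h₂).congr_left fun x => by ring

lemma isLittleO_pow_sub_pow {l : Filter α} {u v w : α → 𝕜} (hu : u =O[l] w) (hv : v =O[l] w)
    (huv : (fun x => u x - v x) =o[l] w) (m : ℕ) :
    (fun x => u x ^ (m + 1) - v x ^ (m + 1)) =o[l] fun x => w x ^ (m + 1) := by
  induction m with
  | zero => simpa using huv
  | succ m ih =>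
    have h₁ := (hu.pow (m + 1)).mul_isLittleO huv
    have h₂ := (ih.mul_isBigO hv).congr_right (g₂ := fun x => w x ^ (m + 1) * w x) fun x => by ring
    exact ((h₁.add h₂).congr_left fun x => by ring).congr_right fun x => by ring

lemma isLittleO_sub_div_mul {l : Filter α} {A g w : α → 𝕜} {b c : 𝕜} (hc : c ≠ 0)
    (hg : (fun x => A x - c * g x) =o[l] g) (hw : (fun x => A x - b * w x) =o[l] w) :
    (fun x => g x - b / c * w x) =o[l] w := by
  have hcg : g =O[l] fun x => c * g x :=
    (isBigO_const_mul_self c⁻¹ (fun x => c * g x) l).congr_left fun x => by field_simp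
  have hgA : g =O[l] A :=
    (hcg.trans (hg.trans_isBigO hcg).right_isBigO_add).congr_right fun x => by ring
  have hAw : A =O[l] w :=
    (hw.isBigO.add ((isBigO_refl w l).const_mul_left b)).congr_left fun x => by ring
  refine ((hw.sub (hg.trans_isBigO (hgA.trans hAw))).const_mul_left c⁻¹).congr_left fun x => ?_
  field_simp
  ring

lemma isLittleO_comp_sub_comp_of_eq_add_smul {f : E → 𝕜} {L : E →L[𝕜] 𝕜} {x : E}
    (hf : HasStrictFDerivAt f L x) {l : Filter α} {γ η : α → E} (hγ : Tendsto γ l (𝓝 x))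
    (hη : Tendsto η l (𝓝 x)) {g : α → 𝕜} {e : E} (hg : ∀ᶠ t in l, η t = γ t + g t • e) :
    (fun t => f (η t) - f (γ t) - L e * g t) =o[l] g := by
  have hpair : Tendsto (fun t => (η t, γ t)) l (𝓝 (x, x)) := by
    rw [nhds_prod_eq]
    exact hη.prodMk hγ
  refine ((hf.isLittleO.comp_tendsto hpair).congr' ?_ .rfl).trans_isBigO (g := fun t => η t - γ t)
    (.of_bound ‖e‖ ?_)
  · filter_upwards [hg] with t ht
    simp [ht, mul_comm]
  · filter_upwards [hg] with t ht
    rw [ht, add_sub_cancel_left, norm_smul, mul_comm]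

lemma isBigO_norm_of_map_zero {F : E → E} (hF : DifferentiableAt 𝕜 F 0) (hF0 : F 0 = 0) :
    (fun z => ‖F z‖) =O[𝓝 0] fun z => ‖z‖ := by
  simpa [hF0] using hF.isBigO_sub.norm_right.norm_left

lemma tendsto_of_map_zero {F : E → E} (hF : DifferentiableAt 𝕜 F 0) (hF0 : F 0 = 0) :
    Tendsto F (𝓝 0) (𝓝 0) := by
  simpa [hF0] using hF.continuousAt.tendsto

lemma isLittleO_apply_sub_mul {ι : Type*} [Fintype ι] {F : (ι → 𝕜) → (ι → 𝕜)}
    (hF : DifferentiableAt 𝕜 F 0) (hF0 : F 0 = 0) {lam : ι → 𝕜}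
    (hdiag : ∀ v j, fderiv 𝕜 F 0 v j = lam j * v j) (j : ι) :
    (fun z => F z j - lam j * z j) =o[𝓝 0] id := by
  simpa [hF0, hdiag, Function.id_def] using (hasFDerivAt_pi'.1 hF.hasFDerivAt j).isLittleO

lemma analyticAt_iterate_of_map_zero {F : E → E} (hF : AnalyticAt 𝕜 F 0) (hF0 : F 0 = 0) (i : ℕ) :
    AnalyticAt 𝕜 F^[i] 0 := by
  induction i with
  | zero => exact analyticAt_id
  | succ i ih =>
    rw [Function.iterate_succ]
    exact AnalyticAt.comp (by rwa [hF0]) hF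

lemma fderiv_iterate_apply {ι : Type*} [Finite ι] {F : (ι → 𝕜) → (ι → 𝕜)}
    (hF : DifferentiableAt 𝕜 F 0) (hF0 : F 0 = 0) {lam : ι → 𝕜}
    (hdiag : ∀ v j, fderiv 𝕜 F 0 v j = lam j * v j) (i : ℕ) (v : ι → 𝕜) (j : ι) :
    fderiv 𝕜 F^[i] 0 v j = lam j ^ i * v j := by
  have := Fintype.ofFinite ι
  rw [(hF.hasFDerivAt.iterate hF0 i).fderiv]
  induction i with
  | zero => simp
  | succ i ih =>
    rw [pow_succ', _root_.mul_apply_eq_comp, hdiag, ih]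
    ring

lemma apply_eq_apply_single_mul {ι R : Type*} [Finite ι] [DecidableEq ι] [CommRing R]
    [NoZeroDivisors R] {lam : ι → R} {i : ι} (hlam : ∀ j ≠ i, lam j ≠ lam i)
    {L : (ι → R) →ₗ[R] R} (hL : ∀ v, L (fun j => lam j * v j) = lam i * L v) (v : ι → R) :
    L v = L (Pi.single i 1) * v i := by
  have hzero (j : ι) (hj : j ≠ i) (x : R) : L (Pi.single j x) = 0 := by
    have h := hL (Pi.single j x)
    rw [show (fun k => lam k * (Pi.single j x : ι → R) k) = lam j • Pi.single j x by
        ext k; rcases eq_or_ne k j with rfl | hk <;> simp [*],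
      map_smul, smul_eq_mul, ← sub_eq_zero, ← sub_mul] at h
    exact (mul_eq_zero.1 h).resolve_left (sub_ne_zero.2 (hlam j hj))
  have := Fintype.ofFinite ι
  calc L v = ∑ j, L (Pi.single j (v j)) := by rw [← map_sum, Finset.univ_sum_single]
    _ = L (Pi.single i (v i)) :=
      Finset.sum_eq_single i (fun j _ hj => hzero j hj (v j)) (by simp)
    _ = L (Pi.single i 1) * v i := by
      rw [mul_comm, ← smul_eq_mul, ← map_smul, ← Pi.single_smul', smul_eq_mul, mul_one]

namespace IsSemiconjugacy

variable {F : E → E} {μ a : 𝕜} {d : ℕ} {h : E → 𝕜}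

lemma isBigO_norm {m N : ℕ} (hh : IsSemiconjugacy F μ a m N h) : h =O[𝓝 0] fun z => ‖z‖ := by
  simpa [hh.map_zero] using hh.analyticAt.differentiableAt.isBigO_sub.norm_right

lemma isBigO_sub_sq (hh : IsSemiconjugacy F μ a (d + 1) (d + 2) h) (hd : 1 ≤ d) :
    (fun z => h (F z) - μ * h z) =O[𝓝 0] fun z => ‖z‖ ^ 2 := by
  have hle (m : ℕ) (hm : 2 ≤ m) : (fun z : E => ‖z‖ ^ m) =O[𝓝 0] fun z => ‖z‖ ^ 2 := by
    refine .of_bound 1 ?_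
    filter_upwards [Metric.ball_mem_nhds (0 : E) one_pos] with z hz
    rw [norm_pow, norm_pow, norm_norm, one_mul]
    exact pow_le_pow_of_le_one (norm_nonneg _) (mem_ball_zero_iff.1 hz).le hm
  have h₁ := hh.isBigO.trans (hle (d + 2) (by omega))
  have h₂ := ((hh.isBigO_norm.pow (d + 1)).trans (hle (d + 1) (by omega))).const_mul_left a
  exact (h₁.add h₂).congr_left fun z => by ring

lemma fderiv_fderiv (hh : IsSemiconjugacy F μ a (d + 1) (d + 2) h) (hd : 1 ≤ d)
    (hF : DifferentiableAt 𝕜 F 0) (hF0 : F 0 = 0) (v : E) :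
    fderiv 𝕜 h 0 (fderiv 𝕜 F 0 v) = μ * fderiv 𝕜 h 0 v := by
  have hh' := hh.analyticAt.differentiableAt.hasFDerivAt
  have hdiff : HasFDerivAt (fun z => h (F z) - μ * h z)
      ((fderiv 𝕜 h 0).comp (fderiv 𝕜 F 0) - μ • fderiv 𝕜 h 0) 0 :=
    (HasFDerivAt.comp 0 (by rwa [hF0]) hF.hasFDerivAt).fun_sub (hh'.const_mul μ)
  have hzero : HasFDerivAt (fun z => h (F z) - μ * h z) (0 : E →L[𝕜] 𝕜) 0 :=
    IsBigO.hasFDerivAt (n := 2) (by simpa using hh.isBigO_sub_sq hd) one_lt_two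
  exact sub_eq_zero.1 (DFunLike.congr_fun (hdiff.unique hzero) v)

lemma exists_fderiv_eq_mul {ι : Type*} [Fintype ι] {F : (ι → 𝕜) → (ι → 𝕜)}
    {h : (ι → 𝕜) → 𝕜} {lam : ι → 𝕜} {i : ι}
    (hh : IsSemiconjugacy F (lam i) a (d + 1) (d + 2) h) (hd : 1 ≤ d)
    (hF : DifferentiableAt 𝕜 F 0) (hF0 : F 0 = 0) (hdiag : ∀ v j, fderiv 𝕜 F 0 v j = lam j * v j)
    (hlam : ∀ j ≠ i, lam j ≠ lam i) :
    ∃ c ≠ 0, ∀ v, fderiv 𝕜 h 0 v = c * v i := by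
  classical
  have hcomp (v : ι → 𝕜) : fderiv 𝕜 h 0 (fun j => lam j * v j) = lam i * fderiv 𝕜 h 0 v := by
    rw [← (funext (hdiag v) : fderiv 𝕜 F 0 v = _)]
    exact hh.fderiv_fderiv hd hF hF0 v
  have hmul (v : ι → 𝕜) : fderiv 𝕜 h 0 v = fderiv 𝕜 h 0 (Pi.single i 1) * v i :=
    apply_eq_apply_single_mul hlam (L := (fderiv 𝕜 h 0).toLinearMap) hcomp v
  refine ⟨_, fun h0 => hh.fderiv_ne_zero (ContinuousLinearMap.ext fun v => ?_), hmul⟩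
  rw [hmul, h0, zero_mul, zero_apply]

lemma isBigO_iterate (hh : IsSemiconjugacy F μ a (d + 1) (d + 2) h) (hd : 1 ≤ d)
    (hF : DifferentiableAt 𝕜 F 0) (hF0 : F 0 = 0) (hμ : μ ≠ 0) (hμd : μ ^ d = 1) (i : ℕ) :
    (fun z => h (F^[i] z) - μ ^ i * (h z + i * (a / μ) * h z ^ (d + 1))) =O[𝓝 0]
      fun z => ‖z‖ ^ (d + 2) := by
  induction i with
  | zero => simpa using isBigO_zero _ _
  | succ i ih =>
    have hFt := tendsto_of_map_zero hF hF0
    have hFO := isBigO_norm_of_map_zero hF hF0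
    have h₁ := (ih.comp_tendsto hFt).trans (hFO.pow (d + 2))
    have h₂ := hh.isBigO.const_mul_left (μ ^ i)
    have hhF : (fun z => h (F z)) =O[𝓝 0] fun z => ‖z‖ :=
      (hh.isBigO_norm.comp_tendsto hFt).trans hFO
    have h₃ := (isBigO_pow_sub_pow hhF (hh.isBigO_norm.const_mul_left μ) (hh.isBigO_sub_sq hd)
      d).const_mul_left (μ ^ i * i * (a / μ))
    refine ((h₁.add h₂).add (h₃.congr_right fun z => by rw [← pow_add])).congr_left fun z => ?_
    simp only [Function.comp_apply, Function.iterate_succ_apply, mul_pow, pow_succ, hμd]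
    push_cast
    field_simp
    ring

variable {γ : 𝕜 → E} {v : E} {q : ℕ}

lemma isLittleO_iterate_comp_sub (hh : IsSemiconjugacy F μ a (d + 1) (d + 2) h) (hd : 1 ≤ d)
    (hF : DifferentiableAt 𝕜 F 0) (hF0 : F 0 = 0) (hμq : μ ^ q = 1) (hμd : μ ^ d = 1)
    (hγ : HasDerivAt γ v 0) (hγ0 : γ 0 = 0) :
    (fun t => h (F^[q] (γ t)) - h (γ t) -
      q * (a / μ) * fderiv 𝕜 h 0 v ^ (d + 1) * t ^ (d + 1)) =o[𝓝 0] fun t => t ^ (d + 1) := by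
  have hμ : μ ≠ 0 := by
    rintro rfl
    exact zero_ne_one ((zero_pow (by omega)).symm.trans hμd)
  have hγt : Tendsto γ (𝓝 0) (𝓝 0) := by simpa [hγ0] using hγ.continuousAt.tendsto
  have hγO : (fun t => ‖γ t‖) =O[𝓝 0] fun t : 𝕜 => t := by
    simpa [hγ0] using hγ.differentiableAt.isBigO_sub.norm_left
  have hiter : (fun t => h (F^[q] (γ t)) - h (γ t) - q * (a / μ) * h (γ t) ^ (d + 1)) =o[𝓝 0]
      fun t : 𝕜 => t ^ (d + 1) := by
    have hO := ((hh.isBigO_iterate hd hF hF0 hμ hμd q).comp_tendsto hγt).trans (hγO.pow (d + 2))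
    refine (hO.congr_left fun t => ?_).trans_isLittleO (isLittleO_pow_pow (by omega))
    simp only [Function.comp_apply, hμq]
    ring
  have hderiv : HasDerivAt (fun t => h (γ t)) (fderiv 𝕜 h 0 v) 0 :=
    HasFDerivAt.comp_hasDerivAt 0
      (by rw [hγ0]; exact hh.analyticAt.differentiableAt.hasFDerivAt) hγ
  have hlin : (fun t => h (γ t) - fderiv 𝕜 h 0 v * t) =o[𝓝 0] fun t : 𝕜 => t := by
    simpa [hγ0, hh.map_zero, mul_comm] using hderiv.isLittleO
  have hpow := isLittleO_pow_sub_pow (hh.isBigO_norm.comp_tendsto hγt |>.trans hγO)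
    ((isBigO_refl _ _).const_mul_left _) hlin d
  refine (hiter.add (hpow.const_mul_left (q * (a / μ)))).congr_left fun t => ?_
  simp only [Function.comp_apply]
  ring

lemma isLittleO_defect (hh : IsSemiconjugacy F μ a (d + 1) (d + 2) h) (hd : 1 ≤ d)
    (hF : DifferentiableAt 𝕜 F 0) (hF0 : F 0 = 0) (hμq : μ ^ q = 1) (hμd : μ ^ d = 1)
    (hγ : HasDerivAt γ v 0) (hγ0 : γ 0 = 0) {e : E} (he : fderiv 𝕜 h 0 e ≠ 0) {g : 𝕜 → 𝕜}
    (hg : ∀ᶠ t in 𝓝 0, F^[q] (γ t) = γ t + g t • e) :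
    (fun t => g t - q * (a / μ) * fderiv 𝕜 h 0 v ^ (d + 1) / fderiv 𝕜 h 0 e * t ^ (d + 1))
      =o[𝓝 0] fun t => t ^ (d + 1) := by
  have hγt : Tendsto γ (𝓝 0) (𝓝 0) := by simpa [hγ0] using hγ.continuousAt.tendsto
  have hFq : Tendsto F^[q] (𝓝 0) (𝓝 0) :=
    tendsto_of_map_zero (hF.iterate hF0 q) (Function.iterate_fixed hF0 q)
  exact isLittleO_sub_div_mul he
    (isLittleO_comp_sub_comp_of_eq_add_smul hh.analyticAt.hasStrictFDerivAt hγt (hFq.comp hγt) hg)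
    (hh.isLittleO_iterate_comp_sub hd hF hF0 hμq hμd hγ hγ0)

end IsSemiconjugacy

end Iterates

section FixedCurve

open Asymptotics

variable {ι 𝕜 : Type*}

/-- The linear automorphism `v ↦ (u j * v j)_j`. -/
noncomputable def diagonalEquiv [NontriviallyNormedField 𝕜] (u : ι → 𝕜) (hu : ∀ j, u j ≠ 0) :
    (ι → 𝕜) ≃L[𝕜] (ι → 𝕜) :=
  ContinuousLinearEquiv.piCongrRight fun j =>
    ContinuousLinearEquiv.unitsEquivAut 𝕜 (Units.mk0 (u j) (hu j))

lemma diagonalEquiv_apply [NontriviallyNormedField 𝕜] (u : ι → 𝕜) (hu : ∀ j, u j ≠ 0) (v : ι → 𝕜)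
    (j : ι) : diagonalEquiv u hu v j = u j * v j := by
  simp [diagonalEquiv, mul_comm]

lemma exists_openPartialHomeomorph_analyticAt_symm {E F : Type*} [RCLike 𝕜]
    [NormedAddCommGroup E] [NormedSpace 𝕜 E] [CompleteSpace E] [NormedAddCommGroup F]
    [NormedSpace 𝕜 F] {f : E → F} {x : E} (hf : AnalyticAt 𝕜 f x)
    {f' : E ≃L[𝕜] F} (hf' : HasFDerivAt f (f' : E →L[𝕜] F) x) :
    ∃ e : OpenPartialHomeomorph E F, ⇑e = f ∧ x ∈ e.source ∧ AnalyticAt 𝕜 e.symm (f x) := by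
  have hs : HasStrictFDerivAt f (f' : E →L[𝕜] F) x := hf'.fderiv ▸ hf.hasStrictFDerivAt
  have he : ⇑(hs.toOpenPartialHomeomorph f) = f := hs.toOpenPartialHomeomorph_coe
  refine ⟨_, he, hs.mem_toOpenPartialHomeomorph_source, ?_⟩
  have := (hs.toOpenPartialHomeomorph f).analyticAt_symm' hs.mem_toOpenPartialHomeomorph_source
    (by rwa [he]) (by rw [he, hf'.fderiv])
  rwa [he] at this

lemma deriv_apply_eq_zero_of_fixed [Finite ι] [NontriviallyNormedField 𝕜]
    {K : (ι → 𝕜) → (ι → 𝕜)} (hK : DifferentiableAt 𝕜 K 0)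
    {κ : ι → 𝕜} (hdiag : ∀ v j, fderiv 𝕜 K 0 v j = κ j * v j) {γ : 𝕜 → (ι → 𝕜)}
    (hγ : DifferentiableAt 𝕜 γ 0) (hγ0 : γ 0 = 0) (hfix : ∀ᶠ t in 𝓝 0, K (γ t) = γ t) {j : ι}
    (hj : κ j ≠ 1) : deriv γ 0 j = 0 := by
  have := Fintype.ofFinite ι
  have hKγ : HasFDerivAt K (fderiv 𝕜 K 0) (γ 0) := by
    rw [hγ0]
    exact hK.hasFDerivAt
  have hderiv := congrFun ((hKγ.comp_hasDerivAt 0 hγ.hasDerivAt).unique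
    (hγ.hasDerivAt.congr_of_eventuallyEq hfix)) j
  rw [hdiag, ← sub_eq_zero, ← sub_one_mul] at hderiv
  exact (mul_eq_zero.1 hderiv).resolve_left (sub_ne_zero.2 hj)

variable [DecidableEq ι]

lemma analyticAt_update [Fintype ι] [NontriviallyNormedField 𝕜] {f : (ι → 𝕜) → ι → 𝕜}
    {g : (ι → 𝕜) → 𝕜} {x : ι → 𝕜} (hf : AnalyticAt 𝕜 f x) (hg : AnalyticAt 𝕜 g x) (i : ι) :
    AnalyticAt 𝕜 (fun z => Function.update (f z) i (g z)) x := by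
  refine analyticAt_pi_iff.2 fun j => ?_
  rcases eq_or_ne j i with rfl | hj
  · simpa using hg
  · simpa [hj] using analyticAt_pi_iff.1 hf j

lemma hasFDerivAt_update_diagonalEquiv [Finite ι] [NontriviallyNormedField 𝕜] {f : (ι → 𝕜) → ι → 𝕜}
    {g : (ι → 𝕜) → 𝕜} {x : ι → 𝕜} (hf : DifferentiableAt 𝕜 f x) (hg : DifferentiableAt 𝕜 g x)
    {i : ι} {u : ι → 𝕜} (hu : ∀ j, u j ≠ 0)
    (hfu : ∀ v, ∀ j ≠ i, fderiv 𝕜 f x v j = u j * v j) (hgu : ∀ v, fderiv 𝕜 g x v = u i * v i) :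
    HasFDerivAt (fun z => Function.update (f z) i (g z))
      (diagonalEquiv u hu : (ι → 𝕜) →L[𝕜] (ι → 𝕜)) x := by
  have := Fintype.ofFinite ι
  refine hasFDerivAt_pi'.2 fun j => ?_
  rcases eq_or_ne j i with rfl | hj
  · simp only [Function.update_self]
    exact hg.hasFDerivAt.congr_fderiv
      (ContinuousLinearMap.ext fun v => by simp [diagonalEquiv_apply, hgu])
  · simp only [Function.update_of_ne hj]
    exact (hasFDerivAt_pi'.1 hf.hasFDerivAt j).congr_fderiv
      (ContinuousLinearMap.ext fun v => by simp [diagonalEquiv_apply, hfu v j hj])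

variable [Fintype ι] [RCLike 𝕜]

lemma exists_openPartialHomeomorph_update {f : (ι → 𝕜) → ι → 𝕜} {g : (ι → 𝕜) → 𝕜}
    (hf : AnalyticAt 𝕜 f 0) (hg : AnalyticAt 𝕜 g 0) (hf0 : f 0 = 0) (hg0 : g 0 = 0) {i : ι}
    {u : ι → 𝕜} (hu : ∀ j, u j ≠ 0) (hfu : ∀ v, ∀ j ≠ i, fderiv 𝕜 f 0 v j = u j * v j)
    (hgu : ∀ v, fderiv 𝕜 g 0 v = u i * v i) :
    ∃ e : OpenPartialHomeomorph (ι → 𝕜) (ι → 𝕜), (∀ z, e z = Function.update (f z) i (g z)) ∧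
      0 ∈ e.source ∧ 0 ∈ e.target ∧ e.symm 0 = 0 ∧ AnalyticAt 𝕜 e.symm 0 := by
  obtain ⟨e, he, hsource, hsymm⟩ := exists_openPartialHomeomorph_analyticAt_symm
    (analyticAt_update hf hg i)
    (hasFDerivAt_update_diagonalEquiv hf.differentiableAt hg.differentiableAt hu hfu hgu)
  have he0 : e 0 = 0 := by simp [he, hf0, hg0]
  exact ⟨e, congrFun he, hsource, he0 ▸ e.map_source hsource,
    (congrArg e.symm he0).symm.trans (e.left_inv hsource),
    by rwa [← congrFun he 0, he0] at hsymm⟩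

lemma exists_curve_update_eq_single {K : (ι → 𝕜) → (ι → 𝕜)} (hK : AnalyticAt 𝕜 K 0)
    (hK0 : K 0 = 0) {κ : ι → 𝕜} (hdiag : ∀ v j, fderiv 𝕜 K 0 v j = κ j * v j) {i : ι}
    (hκ : ∀ j ≠ i, κ j ≠ 1) :
    ∃ γ : 𝕜 → (ι → 𝕜), AnalyticAt 𝕜 γ 0 ∧ γ 0 = 0 ∧
      ∀ᶠ t in 𝓝 0, Function.update (γ t - K (γ t)) i (γ t i) = Pi.single i t := by
  let p : (ι → 𝕜) →L[𝕜] 𝕜 := ContinuousLinearMap.proj i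
  let σ : 𝕜 →L[𝕜] (ι → 𝕜) := ContinuousLinearMap.single 𝕜 (fun _ => 𝕜) i
  have hu (j : ι) : Function.update (1 - κ) i 1 j ≠ 0 := by
    rcases eq_or_ne j i with rfl | hj
    · simp
    · simpa [hj] using sub_ne_zero.2 (hκ j hj).symm
  obtain ⟨e, he, -, htarget, hsymm0, hsymm⟩ := exists_openPartialHomeomorph_update
    (i := i) (f := fun z => z - K z) (analyticAt_id.fun_sub hK) (p.analyticAt 0) (by simp [hK0])
    (map_zero p) hu
    (fun v j hj => by simp [fderiv_fun_sub, hK.differentiableAt, hdiag, hj, sub_mul])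
    (fun v => by simp [p])
  refine ⟨fun t => e.symm (σ t), AnalyticAt.comp (by rwa [map_zero]) (σ.analyticAt 0),
    by simp [hsymm0], ?_⟩
  have hσ : Tendsto σ (𝓝 0) (𝓝 0) := by simpa using σ.continuous.tendsto 0
  filter_upwards [hσ.eventually (e.open_target.mem_nhds htarget)] with t ht
  exact (he _).symm.trans (e.right_inv ht)

lemma exists_curve_fixed_off_axis {K : (ι → 𝕜) → (ι → 𝕜)} (hK : AnalyticAt 𝕜 K 0) (hK0 : K 0 = 0)
    {κ : ι → 𝕜} (hdiag : ∀ v j, fderiv 𝕜 K 0 v j = κ j * v j) {i : ι} (hκ : ∀ j ≠ i, κ j ≠ 1) :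
    ∃ (γ : 𝕜 → (ι → 𝕜)) (g : 𝕜 → 𝕜), AnalyticAt 𝕜 γ 0 ∧ γ 0 = 0 ∧ deriv γ 0 i = 1 ∧
      AnalyticAt 𝕜 g 0 ∧ ∀ᶠ t in 𝓝 0, K (γ t) = γ t + g t • Pi.single i 1 := by
  obtain ⟨γ, hγ, hγ0, heq⟩ := exists_curve_update_eq_single hK hK0 hdiag hκ
  refine ⟨γ, fun t => K (γ t) i - γ t i, hγ, hγ0, ?_, ?_, ?_⟩
  · refine (hasDerivAt_pi.1 hγ.differentiableAt.hasDerivAt i).unique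
      ((hasDerivAt_id (0 : 𝕜)).congr_of_eventuallyEq ?_)
    filter_upwards [heq] with t ht
    simpa using congrFun ht i
  · have hKγ : AnalyticAt 𝕜 (fun t => K (γ t)) 0 := AnalyticAt.comp (by rwa [hγ0]) hγ
    exact (analyticAt_pi_iff.1 hKγ i).fun_sub (analyticAt_pi_iff.1 hγ i)
  · filter_upwards [heq] with t ht
    ext j
    rcases eq_or_ne j i with rfl | hj
    · simp
    · have hj' := congrFun ht j
      simp only [Function.update_of_ne hj, Pi.single_eq_of_ne hj, Pi.sub_apply] at hj'
      simp [hj, (sub_eq_zero.1 hj').symm]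

end FixedCurve

section Order

open Asymptotics

lemma eq_zero_of_isLittleO_const_mul_pow {𝕜 : Type*} [NontriviallyNormedField 𝕜] {b : 𝕜} {m : ℕ}
    (h : (fun t : 𝕜 => b * t ^ m) =o[𝓝 0] fun t : 𝕜 => t ^ m) : b = 0 := by
  by_contra hb
  have hself : (fun t : 𝕜 => t ^ m) =o[𝓝[≠] 0] fun t : 𝕜 => t ^ m :=
    ((h.const_mul_left b⁻¹).congr_left fun t => by field_simp).mono nhdsWithin_le_nhds
  refine isLittleO_irrefl (Eventually.frequently ?_) hself
  filter_upwards [self_mem_nhdsWithin] with t ht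
  exact pow_ne_zero m ht

lemma eventually_eq_zero_of_forall_isLittleO_pow {𝕜 : Type*} [NontriviallyNormedField 𝕜]
    {g : 𝕜 → 𝕜} (hg : AnalyticAt 𝕜 g 0) (h : ∀ m : ℕ, g =o[𝓝 0] fun t => t ^ m) :
    ∀ᶠ t in 𝓝 0, g t = 0 := by
  by_contra hne
  obtain ⟨m, u, hu, hu0, hgu⟩ := hg.exists_eventuallyEq_pow_smul_nonzero_iff.2 hne
  have hsub : (fun t => u t - u 0) =o[𝓝 0] fun _ => (1 : 𝕜) := by
    rw [isLittleO_one_iff]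
    simpa using hu.continuousAt.tendsto.sub_const (u 0)
  have hmul := (isBigO_refl (fun t : 𝕜 => t ^ m) (𝓝 0)).mul_isLittleO hsub
  simp only [mul_one] at hmul
  refine hu0 (eq_zero_of_isLittleO_const_mul_pow (m := m) (((h m).sub hmul).congr' ?_ .rfl))
  filter_upwards [hgu] with t ht
  simp only [ht, sub_zero, smul_eq_mul]
  ring

lemma eq_zero_of_prod_pow_eq_one {ι R : Type*} [Fintype ι] [CommRing R] [LinearOrder R]
    [IsStrictOrderedRing R] {x : ι → R} (h0 : ∀ i, 0 ≤ x i) (h1 : ∀ i, x i ≤ 1) {l : ι → ℕ}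
    (hprod : ∏ i, x i ^ l i = 1) {i : ι} (hi : x i < 1) : l i = 0 := by
  classical
  by_contra hli
  have herase : ∏ j ∈ Finset.univ.erase i, x j ^ l j ≤ 1 :=
    Finset.prod_le_one (fun j _ => pow_nonneg (h0 j) _) fun j _ => pow_le_one₀ (h0 j) (h1 j)
  refine (pow_lt_one₀ (h0 i) hi hli).not_ge ?_
  rw [← hprod, ← Finset.mul_prod_erase _ _ (Finset.mem_univ i)]
  exact mul_le_of_le_one_right (pow_nonneg (h0 i) _) herase

variable {n : ℕ} [NeZero n]

/-- A germ `F` fixing `0` whose differential is diagonal, with first eigenvalue a primitive `q`-th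
root of unity and all other eigenvalues of modulus less than `1`. -/
structure IsQuasiParabolic (F : (Fin n → ℂ) → (Fin n → ℂ)) (lam : Fin n → ℂ) (q : ℕ) : Prop where
  analyticAt : AnalyticAt ℂ F 0
  map_zero : F 0 = 0
  fderiv_apply : ∀ v j, fderiv ℂ F 0 v j = lam j * v j
  pos : 0 < q
  isPrimitiveRoot : IsPrimitiveRoot (lam 0) q
  norm_lt_one : ∀ j ≠ 0, ‖lam j‖ < 1

namespace IsQuasiParabolic

variable {F : (Fin n → ℂ) → (Fin n → ℂ)} {lam : Fin n → ℂ} {q : ℕ}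

lemma norm_lam_zero (hF : IsQuasiParabolic F lam q) : ‖lam 0‖ = 1 :=
  hF.isPrimitiveRoot.norm'_eq_one hF.pos.ne'

lemma lam_zero_ne_zero (hF : IsQuasiParabolic F lam q) : lam 0 ≠ 0 :=
  hF.isPrimitiveRoot.ne_zero hF.pos.ne'

lemma norm_lam_le_one (hF : IsQuasiParabolic F lam q) (j : Fin n) : ‖lam j‖ ≤ 1 := by
  rcases eq_or_ne j 0 with rfl | hj
  · exact hF.norm_lam_zero.le
  · exact (hF.norm_lt_one j hj).le

lemma lam_ne (hF : IsQuasiParabolic F lam q) (j : Fin n) (hj : j ≠ 0) : lam j ≠ lam 0 :=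
  fun h => (hF.norm_lt_one j hj).ne (h ▸ hF.norm_lam_zero)

lemma lam_pow_ne_one (hF : IsQuasiParabolic F lam q) (j : Fin n) (hj : j ≠ 0) :
    lam j ^ q ≠ 1 := by
  intro h
  refine (pow_lt_one₀ (norm_nonneg _) (hF.norm_lt_one j hj) hF.pos.ne').ne ?_
  rw [← norm_pow, h, norm_one]

lemma pow_mul_eq_one (hF : IsQuasiParabolic F lam q) (k : ℕ) : lam 0 ^ (q * k) = 1 := by
  rw [pow_mul, hF.isPrimitiveRoot.pow_eq_one, one_pow]

lemma isResonance_single_iff (hF : IsQuasiParabolic F lam q) {m : ℕ} :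
    IsResonance lam 0 (Finsupp.single 0 m) ↔ ∃ k, 1 ≤ k ∧ m = k * q + 1 := by
  rw [IsResonance, Finsupp.degree_single, Finsupp.prod_single_index (by simp)]
  constructor
  · rintro ⟨hm, hpow⟩
    obtain ⟨m, rfl⟩ := Nat.exists_eq_add_of_le' (one_le_two.trans hm)
    rw [pow_succ, eq_comm, mul_eq_right₀ hF.lam_zero_ne_zero,
      hF.isPrimitiveRoot.pow_eq_one_iff_dvd] at hpow
    obtain ⟨k, rfl⟩ := hpow
    exact ⟨k, Nat.pos_of_ne_zero fun hk => by simp [hk] at hm, by rw [mul_comm]⟩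
  · rintro ⟨k, hk, rfl⟩
    refine ⟨by have := Nat.mul_pos hk hF.pos; omega, ?_⟩
    rw [pow_succ, mul_comm k, hF.pow_mul_eq_one, one_mul]

lemma eq_single_of_isResonance (hF : IsQuasiParabolic F lam q) {l : Fin n →₀ ℕ}
    (hl : IsResonance lam 0 l) : l = Finsupp.single 0 (l 0) := by
  have hprod : ∏ i, ‖lam i‖ ^ l i = 1 := by
    simpa [Finsupp.prod_fintype, hF.norm_lam_zero] using (congrArg norm hl.2).symm
  ext i
  rcases eq_or_ne i 0 with rfl | hi
  · simp
  · simp [hi, eq_zero_of_prod_pow_eq_one (fun i => norm_nonneg (lam i)) hF.norm_lam_le_one hprod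
      (hF.norm_lt_one i hi)]

lemma isOneResonant (hF : IsQuasiParabolic F lam q) :
    IsOneResonant lam 1 (Finsupp.single 0 q) := by
  refine ⟨by simpa using hF.pos.ne', fun j hj => ?_, fun j hj l => ?_⟩
  · have hj0 : j ≠ 0 := fun h => by simp [h] at hj
    simp [hj0]
  obtain rfl := eq_zero_of_val_lt_one hj
  simp only [Finsupp.smul_single, smul_eq_mul, ← Finsupp.single_add]
  constructor
  · intro hl
    have hsingle := hF.eq_single_of_isResonance hl
    rw [hsingle] at hl
    obtain ⟨k, hk, hm⟩ := hF.isResonance_single_iff.1 hl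
    exact ⟨k, hk, hm ▸ hsingle⟩
  · rintro ⟨k, hk, rfl⟩
    exact hF.isResonance_single_iff.2 ⟨k, hk, rfl⟩

lemma exists_isLittleO_of_hasResonantForm (hF : IsQuasiParabolic F lam q) {k : ℕ}
    (hk : HasResonantForm F lam 1 (Finsupp.single 0 q) k) {γ : ℂ → (Fin n → ℂ)} {v : Fin n → ℂ}
    (hγ : HasDerivAt γ v 0) (hγ0 : γ 0 = 0) (hv : v 0 ≠ 0) {g : ℂ → ℂ}
    (hg : ∀ᶠ t in 𝓝 0, F^[q] (γ t) = γ t + g t • Pi.single 0 1) :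
    ∃ b ≠ 0, (fun t => g t - b * t ^ (q * k + 1)) =o[𝓝 0] fun t => t ^ (q * k + 1) := by
  have hd : 1 ≤ q * k := Nat.mul_pos hF.pos hk.1
  obtain ⟨a, ha, h, hh⟩ := hk.exists_isSemiconjugacy hF.map_zero
  obtain ⟨c, hc, hdh⟩ := hh.exists_fderiv_eq_mul hd hF.analyticAt.differentiableAt hF.map_zero
    hF.fderiv_apply hF.lam_ne
  have hq : (q : ℂ) ≠ 0 := Nat.cast_ne_zero.2 hF.pos.ne'
  have h0 := hF.lam_zero_ne_zero
  have hO := hh.isLittleO_defect hd hF.analyticAt.differentiableAt hF.map_zero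
    hF.isPrimitiveRoot.pow_eq_one (hF.pow_mul_eq_one k) hγ hγ0 (by simpa [hdh] using hc) hg
  simp only [hdh, Pi.single_eq_same] at hO
  exact ⟨_, div_ne_zero (mul_ne_zero (mul_ne_zero hq (div_ne_zero ha h0))
    (pow_ne_zero _ (mul_ne_zero hc hv))) (mul_ne_zero hc one_ne_zero), hO⟩

lemma isLittleO_pow_of_formallyLinearizable (hF : IsQuasiParabolic F lam q)
    (hL : FormallyLinearizable F lam 1) {γ : ℂ → (Fin n → ℂ)} {v : Fin n → ℂ}
    (hγ : HasDerivAt γ v 0) (hγ0 : γ 0 = 0) {g : ℂ → ℂ}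
    (hg : ∀ᶠ t in 𝓝 0, F^[q] (γ t) = γ t + g t • Pi.single 0 1) (m : ℕ) :
    g =o[𝓝 0] fun t => t ^ m := by
  have hd : 1 ≤ q * (m + 1) := Nat.mul_pos hF.pos m.succ_pos
  obtain ⟨h, hh⟩ := hL.exists_isSemiconjugacy hF.map_zero (N := q * (m + 1) + 2) (by omega)
    (q * (m + 1) + 1)
  obtain ⟨c, hc, hdh⟩ := hh.exists_fderiv_eq_mul hd hF.analyticAt.differentiableAt hF.map_zero
    hF.fderiv_apply hF.lam_ne
  have hO := hh.isLittleO_defect hd hF.analyticAt.differentiableAt hF.map_zero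
    hF.isPrimitiveRoot.pow_eq_one (hF.pow_mul_eq_one _) hγ hγ0 (by simpa [hdh] using hc) hg
  simp only [zero_div, mul_zero, zero_mul, sub_zero] at hO
  exact hO.trans (isLittleO_pow_pow (by nlinarith [hF.pos]))

lemma exists_curve (hF : IsQuasiParabolic F lam q) :
    ∃ (γ : ℂ → (Fin n → ℂ)) (g : ℂ → ℂ), AnalyticAt ℂ γ 0 ∧ γ 0 = 0 ∧ deriv γ 0 0 = 1 ∧
      AnalyticAt ℂ g 0 ∧ ∀ᶠ t in 𝓝 0, F^[q] (γ t) = γ t + g t • Pi.single 0 1 :=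
  exists_curve_fixed_off_axis (analyticAt_iterate_of_map_zero hF.analyticAt hF.map_zero q)
    (Function.iterate_fixed hF.map_zero q)
    (fderiv_iterate_apply hF.analyticAt.differentiableAt hF.map_zero hF.fderiv_apply q)
    hF.lam_pow_ne_one

lemma eq_of_hasResonantForm (hF : IsQuasiParabolic F lam q) {k k' : ℕ}
    (hk : HasResonantForm F lam 1 (Finsupp.single 0 q) k)
    (hk' : HasResonantForm F lam 1 (Finsupp.single 0 q) k') : k = k' := by
  wlog hlt : k < k' generalizing k k'
  · by_contra hne
    exact hne (this hk' hk (by omega)).symm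
  exfalso
  obtain ⟨γ, g, hγ, hγ0, hγ1, -, hgγ⟩ := hF.exists_curve
  have hv : deriv γ 0 0 ≠ 0 := by simp [hγ1]
  have hd := hγ.differentiableAt.hasDerivAt
  obtain ⟨b, hb, hO⟩ := hF.exists_isLittleO_of_hasResonantForm hk hd hγ0 hv hgγ
  obtain ⟨b', -, hO'⟩ := hF.exists_isLittleO_of_hasResonantForm hk' hd hγ0 hv hgγ
  have hbig : g =O[𝓝 0] fun t : ℂ => t ^ (q * k' + 1) :=
    (hO'.isBigO.add ((isBigO_refl _ _).const_mul_left b')).congr_left fun t => by ring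
  have hlittle : g =o[𝓝 0] fun t : ℂ => t ^ (q * k + 1) :=
    hbig.trans_isLittleO (isLittleO_pow_pow (by gcongr; exact hF.pos))
  exact hb (eq_zero_of_isLittleO_const_mul_pow ((hlittle.sub hO).congr_left fun t => by ring))

lemma hasFixedCurve_of_formallyLinearizable (hF : IsQuasiParabolic F lam q)
    (hL : FormallyLinearizable F lam 1) : HasFixedCurve F^[q] := by
  obtain ⟨γ, g, hγ, hγ0, hγ1, hg, hgγ⟩ := hF.exists_curve
  have hzero := eventually_eq_zero_of_forall_isLittleO_pow hg
    (hF.isLittleO_pow_of_formallyLinearizable hL hγ.differentiableAt.hasDerivAt hγ0 hgγ)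
  refine ⟨γ, hγ, hγ0, fun h => by simp [h] at hγ1, ?_⟩
  filter_upwards [hzero, hgγ] with t ht hγt
  rw [hγt, ht, zero_smul, add_zero]

lemma not_hasResonantForm_of_hasFixedCurve (hF : IsQuasiParabolic F lam q)
    (hC : HasFixedCurve F^[q]) (k : ℕ) : ¬ HasResonantForm F lam 1 (Finsupp.single 0 q) k := by
  intro hk
  obtain ⟨γ, hγ, hγ0, hγ1, hfix⟩ := hC
  have hiter := analyticAt_iterate_of_map_zero hF.analyticAt hF.map_zero q
  have hdiag := fderiv_iterate_apply hF.analyticAt.differentiableAt hF.map_zero hF.fderiv_apply q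
  have hv : deriv γ 0 0 ≠ 0 := by
    refine fun h0 => hγ1 (funext fun j => ?_)
    rcases eq_or_ne j 0 with rfl | hj
    · exact h0
    · exact deriv_apply_eq_zero_of_fixed hiter.differentiableAt hdiag hγ.differentiableAt hγ0 hfix
        (hF.lam_pow_ne_one j hj)
  obtain ⟨b, hb, hO⟩ := hF.exists_isLittleO_of_hasResonantForm hk hγ.differentiableAt.hasDerivAt
    hγ0 hv (g := fun _ => 0) (by simpa using hfix)
  exact hb (eq_zero_of_isLittleO_const_mul_pow (hO.neg_left.congr_left fun t => by ring))

lemma formallyLinearizable_or_hasResonantForm (hF : IsQuasiParabolic F lam q) :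
    FormallyLinearizable F lam 1 ∨ ∃ k, HasResonantForm F lam 1 (Finsupp.single 0 q) k := by
  obtain ⟨f, hf⟩ := exists_hasTaylorSeries hF.analyticAt
  exact hF.isOneResonant.formallyLinearizable_or_hasResonantForm hf
    (hf.hasDiagonalPart hF.map_zero hF.analyticAt.differentiableAt hF.fderiv_apply)

lemma formallyLinearizable_iff_hasFixedCurve (hF : IsQuasiParabolic F lam q) :
    FormallyLinearizable F lam 1 ↔ HasFixedCurve F^[q] := by
  refine ⟨hF.hasFixedCurve_of_formallyLinearizable, fun h => ?_⟩
  refine hF.formallyLinearizable_or_hasResonantForm.resolve_right ?_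
  rintro ⟨k, hk⟩
  exact hF.not_hasResonantForm_of_hasFixedCurve h k hk

lemma resonanceOrder_eq (hF : IsQuasiParabolic F lam q) {k : ℕ}
    (hk : HasResonantForm F lam 1 (Finsupp.single 0 q) k) :
    resonanceOrder F lam 1 (Finsupp.single 0 q) = k := by
  refine le_antisymm (sInf_le ⟨k, hk, rfl⟩) (le_sInf ?_)
  rintro _ ⟨k', hk', rfl⟩
  rw [hF.eq_of_hasResonantForm hk hk']

lemma resonanceOrder_eq_top_iff (hF : IsQuasiParabolic F lam q) :
    resonanceOrder F lam 1 (Finsupp.single 0 q) = ⊤ ↔ FormallyLinearizable F lam 1 := by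
  constructor
  · intro h
    refine hF.formallyLinearizable_or_hasResonantForm.resolve_right ?_
    rintro ⟨k, hk⟩
    exact ENat.natCast_ne_top k ((hF.resonanceOrder_eq hk).symm.trans h)
  · intro h
    rw [resonanceOrder, sInf_eq_top]
    rintro x ⟨k, hk, -⟩
    exact absurd hk (hF.not_hasResonantForm_of_hasFixedCurve
      (hF.hasFixedCurve_of_formallyLinearizable h) k)

lemma hasResonantForm_of_resonanceOrder_eq (hF : IsQuasiParabolic F lam q) {k : ℕ}
    (hk : resonanceOrder F lam 1 (Finsupp.single 0 q) = k) :
    HasResonantForm F lam 1 (Finsupp.single 0 q) k := by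
  obtain h | ⟨k', hk'⟩ := hF.formallyLinearizable_or_hasResonantForm
  · rw [hF.resonanceOrder_eq_top_iff.2 h] at hk
    exact absurd hk.symm (ENat.natCast_ne_top k)
  · rwa [show k = k' by exact_mod_cast hk.symm.trans (hF.resonanceOrder_eq hk')]

end IsQuasiParabolic

end Order

section FatouCoordinate

open Asymptotics

variable {α 𝕜 : Type*} [NontriviallyNormedField 𝕜] {l : Filter α} {x y : α → 𝕜} {μ a : 𝕜} {d : ℕ}

lemma isLittleO_div_mul_sub_one (hx : Tendsto x l (𝓝 0)) (hx0 : ∀ᶠ t in l, x t ≠ 0) (hμ : μ ≠ 0)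
    (hy : (fun t => y t - (μ * x t + a * x t ^ (d + 1))) =O[l] fun t => x t ^ (d + 2)) :
    (fun t => y t / (μ * x t) - 1 - a / μ * x t ^ d) =o[l] fun t => x t ^ d := by
  have hdiv : (fun t => y t / (μ * x t) - 1 - a / μ * x t ^ d) =O[l]
      fun t => x t ^ d * (x t * μ⁻¹) := by
    refine (hy.mul (isBigO_refl (fun t => (μ * x t)⁻¹) l)).congr' ?_ ?_ <;>
      filter_upwards [hx0] with t ht <;> field_simp <;> ring
  have hsmall : (fun t => x t * μ⁻¹) =o[l] fun _ => (1 : 𝕜) := by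
    rw [isLittleO_one_iff]
    simpa using hx.mul_const μ⁻¹
  refine hdiv.trans_isLittleO ?_
  simpa only [mul_one] using (isBigO_refl (fun t => x t ^ d) l).mul_isLittleO hsmall

lemma isBigO_div_mul_sub_one (hx : Tendsto x l (𝓝 0)) (hx0 : ∀ᶠ t in l, x t ≠ 0) (hμ : μ ≠ 0)
    (hy : (fun t => y t - (μ * x t + a * x t ^ (d + 1))) =O[l] fun t => x t ^ (d + 2)) :
    (fun t => y t / (μ * x t) - 1) =O[l] fun t => x t ^ d :=
  ((isLittleO_div_mul_sub_one hx hx0 hμ hy).isBigO.add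
    ((isBigO_refl _ _).const_mul_left (a / μ))).congr_left fun t => by ring

lemma tendsto_div_mul_one (hx : Tendsto x l (𝓝 0)) (hx0 : ∀ᶠ t in l, x t ≠ 0) (hμ : μ ≠ 0)
    (hd : d ≠ 0)
    (hy : (fun t => y t - (μ * x t + a * x t ^ (d + 1))) =O[l] fun t => x t ^ (d + 2)) :
    Tendsto (fun t => y t / (μ * x t)) l (𝓝 1) := by
  have hpow : Tendsto (fun t => x t ^ d) l (𝓝 0) := by simpa [hd] using hx.pow d
  simpa using ((isBigO_div_mul_sub_one hx hx0 hμ hy).trans_tendsto hpow).add_const 1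

/- In the coordinate `(c / x) ^ d` the map `x ↦ μ x + a x ^ (d + 1) + ⋯` is asymptotic to the
translation by `-d (a / μ) c ^ d`, and `c` is chosen to make this equal to `1`. -/
lemma tendsto_div_pow_sub_div_pow (hx : Tendsto x l (𝓝 0)) (hx0 : ∀ᶠ t in l, x t ≠ 0)
    (hd : d ≠ 0) (hμ : μ ^ d = 1)
    (hy : (fun t => y t - (μ * x t + a * x t ^ (d + 1))) =O[l] fun t => x t ^ (d + 2)) {c : 𝕜}
    (hc : c ^ d * (d * (a / μ)) = -1) :
    Tendsto (fun t => (c / y t) ^ d - (c / x t) ^ d) l (𝓝 1) := by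
  have hμ0 : μ ≠ 0 := by
    rintro rfl
    simp [hd] at hμ
  set r : α → 𝕜 := fun t => y t / (μ * x t) with hr
  have hder : HasDerivAt (fun w : 𝕜 => w⁻¹ ^ d) (-(d : 𝕜)) 1 := by
    simpa using (hasDerivAt_inv (one_ne_zero (α := 𝕜))).fun_pow d
  have hlin : (fun t => (r t)⁻¹ ^ d - 1 + d * (r t - 1)) =o[l] fun t => x t ^ d := by
    refine ((hder.isLittleO.comp_tendsto (tendsto_div_mul_one hx hx0 hμ0 hd hy)).trans_isBigO
      (isBigO_div_mul_sub_one hx hx0 hμ0 hy)).congr_left fun t => ?_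
    simp only [Function.comp_apply, inv_one, one_pow, smul_eq_mul, hr]
    ring
  have hmain : (fun t => (r t)⁻¹ ^ d - 1 + d * (a / μ) * x t ^ d) =o[l] fun t => x t ^ d :=
    (hlin.sub ((isLittleO_div_mul_sub_one hx hx0 hμ0 hy).const_mul_left (d : 𝕜))).congr_left
      fun t => by ring
  have hlim := (hmain.tendsto_div_nhds_zero.const_mul (c ^ d)).add_const 1
  rw [mul_zero, zero_add] at hlim
  refine hlim.congr' ?_
  filter_upwards [hx0] with t ht
  have hyt : (c / y t) ^ d = c ^ d / x t ^ d * (r t)⁻¹ ^ d := by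
    simp only [hr, inv_div, div_pow, mul_pow, hμ, one_mul]
    field_simp
  rw [hyt, div_pow]
  field_simp at hc ⊢
  linear_combination x t ^ d * hc

end FatouCoordinate

section Petal

open Complex

lemma mul_cpow_of_re_pos {u w : ℂ} (hu : 0 < u.re) (hw : 0 < w.re) (s : ℂ) :
    (u * w) ^ s = u ^ s * w ^ s := by
  have ne_zero {v : ℂ} (hv : 0 < v.re) : v ≠ 0 := fun h => by simp [h] at hv
  have arg_lt {v : ℂ} (hv : 0 < v.re) := abs_lt.1 (abs_arg_lt_pi_div_two_iff.2 (Or.inl hv))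
  have hlog : log (u * w) = log u + log w :=
    log_mul (ne_zero hu) (ne_zero hw)
      ⟨by linarith [(arg_lt hu).1, (arg_lt hw).1], by linarith [(arg_lt hu).2, (arg_lt hw).2]⟩
  rw [cpow_def_of_ne_zero (mul_ne_zero (ne_zero hu) (ne_zero hw)), hlog, add_mul, exp_add,
    cpow_def_of_ne_zero (ne_zero hu), cpow_def_of_ne_zero (ne_zero hw)]

lemma eventually_mul_pow_cpow_inv {d : ℕ} (hd : d ≠ 0) :
    ∀ᶠ s in 𝓝 (1 : ℂ), ∀ u : ℂ, 0 < u.re →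
      (u * s ^ d) ^ ((d : ℂ)⁻¹) = u ^ ((d : ℂ)⁻¹) * s := by
  have hre : ∀ᶠ s in 𝓝 (1 : ℂ), 0 < (s ^ d).re :=
    (continuous_re.comp (continuous_pow d)).continuousAt.eventually_const_lt (by simp)
  have harg : ∀ᶠ s in 𝓝 (1 : ℂ), |arg s| < Real.pi / d :=
    (continuousAt_arg (by simp)).abs.eventually_lt_const
      (by simpa only [arg_one, abs_zero] using by positivity)
  filter_upwards [hre, harg] with s hs hs' u hu
  rw [mul_cpow_of_re_pos hu hs,
    pow_cpow_nat_inv hd (abs_lt.1 hs').1 (abs_lt.1 hs').2.le]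

/-- A branch of the inverse of the Fatou coordinate `x ↦ (c / x) ^ d`. -/
noncomputable def petalRoot (c : ℂ) (d : ℕ) (u : ℂ) : ℂ := c / u ^ ((d : ℂ)⁻¹)

/-- The attracting petal in the direction `μ`, a `d`-th root of unity: the component of
`{x | R < ((c / x) ^ d).re}` parametrized by the branch `μ * petalRoot c d`. -/
def petal (c : ℂ) (d : ℕ) (R : ℝ) (μ : ℂ) : Set ℂ :=
  (fun u => μ * petalRoot c d u) '' {u | R < u.re}

variable {c : ℂ} {d : ℕ} {R : ℝ} {μ : ℂ}

lemma div_petalRoot_pow (hc : c ≠ 0) (hd : d ≠ 0) (hμ : μ ^ d = 1) (u : ℂ) :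
    (c / (μ * petalRoot c d u)) ^ d = u := by
  rw [petalRoot, div_pow, mul_pow, div_pow, cpow_nat_inv_pow u hd, hμ, one_mul,
    div_div_cancel₀ (pow_ne_zero d hc)]

lemma continuousAt_petalRoot {u : ℂ} (hu : 0 < u.re) : ContinuousAt (petalRoot c d) u := by
  have hu0 : u ≠ 0 := fun h => by simp [h] at hu
  refine continuousAt_const.div (continuousAt_id.cpow continuousAt_const (Or.inl hu)) ?_
  simp [cpow_eq_zero_iff, hu0]

lemma mul_petalRoot_mem_petal {u : ℂ} (hu : R < u.re) : μ * petalRoot c d u ∈ petal c d R μ :=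
  mem_image_of_mem _ hu

lemma mem_petal_iff (hc : c ≠ 0) (hd : d ≠ 0) (hμ : μ ^ d = 1) {x : ℂ} :
    x ∈ petal c d R μ ↔ R < ((c / x) ^ d).re ∧ x = μ * petalRoot c d ((c / x) ^ d) := by
  constructor
  · rintro ⟨u, hu, rfl⟩
    simp only [div_petalRoot_pow hc hd hμ, and_true]
    exact hu
  · rintro ⟨hre, hx⟩
    exact hx ▸ mul_petalRoot_mem_petal hre

lemma ne_zero_of_mem_petal (hc : c ≠ 0) (hd : d ≠ 0) (hR : 0 ≤ R) (hμ : μ ^ d = 1) {x : ℂ}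
    (hx : x ∈ petal c d R μ) : x ≠ 0 := by
  rintro rfl
  have hre := ((mem_petal_iff hc hd hμ).1 hx).1
  simp only [div_zero, zero_pow hd, zero_re] at hre
  exact hre.not_ge hR

lemma disjoint_petal (hc : c ≠ 0) (hd : d ≠ 0) (hR : 0 ≤ R) {μ' : ℂ} (hμ : μ ^ d = 1)
    (hμ' : μ' ^ d = 1) (hne : μ ≠ μ') : Disjoint (petal c d R μ) (petal c d R μ') := by
  rw [Set.disjoint_left]
  intro x hx hx'
  have hroot := ((mem_petal_iff hc hd hμ).1 hx).2
  have hroot' := ((mem_petal_iff hc hd hμ').1 hx').2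
  refine hne (mul_right_cancel₀ ?_ (hroot.symm.trans hroot'))
  exact right_ne_zero_of_mul (hroot ▸ ne_zero_of_mem_petal hc hd hR hμ hx)

lemma mul_mem_petal {x : ℂ} (hx : x ∈ petal c d R μ) (l : ℂ) : l * x ∈ petal c d R (l * μ) := by
  obtain ⟨u, hu, rfl⟩ := hx
  exact ⟨u, hu, mul_assoc _ _ _⟩

lemma eventually_mul_mem_petal (hc : c ≠ 0) (hd : d ≠ 0) :
    ∀ᶠ r in 𝓝 (1 : ℂ), ∀ R : ℝ, 0 ≤ R → ∀ μ : ℂ, μ ^ d = 1 → ∀ x ∈ petal c d R μ,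
      R < ((c / (x * r)) ^ d).re → x * r ∈ petal c d R μ := by
  have hinv : Tendsto (fun r : ℂ => r⁻¹) (𝓝 1) (𝓝 1) := by
    simpa using (continuousAt_inv₀ (one_ne_zero (α := ℂ))).tendsto
  filter_upwards [hinv.eventually (eventually_mul_pow_cpow_inv hd)] with r hr R hR μ hμ x hx hxr
  obtain ⟨hre, hroot⟩ := (mem_petal_iff hc hd hμ).1 hx
  have hmul : (c / (x * r)) ^ d = (c / x) ^ d * r⁻¹ ^ d := by
    rw [← mul_pow, div_mul_eq_div_div, div_eq_mul_inv (c / x)]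
  refine (mem_petal_iff hc hd hμ).2 ⟨hxr, ?_⟩
  rw [hmul, petalRoot, hr _ (hR.trans_lt hre), div_mul_eq_div_div, div_inv_eq_mul, ← mul_assoc,
    ← petalRoot, ← hroot]

lemma isOpen_petal (hc : c ≠ 0) (hd : d ≠ 0) (hR : 0 ≤ R) (hμ : μ ^ d = 1) :
    IsOpen (petal c d R μ) := by
  rw [isOpen_iff_mem_nhds]
  intro x hx
  have hx0 := ne_zero_of_mem_petal hc hd hR hμ hx
  have hre : ∀ᶠ y in 𝓝 x, R < ((c / y) ^ d).re :=
    (continuous_re.continuousAt.comp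
      ((continuousAt_const.div continuousAt_id hx0).pow d)).eventually_const_lt
      ((mem_petal_iff hc hd hμ).1 hx).1
  have hdiv : Tendsto (fun y => y / x) (𝓝 x) (𝓝 1) := by
    simpa [hx0] using (continuousAt_id (x := x)).tendsto.div_const x
  filter_upwards [hre, hdiv.eventually (eventually_mul_mem_petal hc hd)] with y hy hyx
  have hmem := hyx R hR μ hμ x hx
  rw [mul_div_cancel₀ y hx0] at hmem
  exact hmem hy

end Petal

section Cone

open Asymptotics

variable {𝕜 ι : Type*} {i : ι}

/-- The points at which the function `h`, which is to replace the `i`-th coordinate, dominates the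
other coordinates. -/
def dominationCone [NormedField 𝕜] (h : (ι → 𝕜) → 𝕜) (i : ι) : Set (ι → 𝕜) :=
  {z | h z ≠ 0 ∧ ∀ j ≠ i, ‖z j‖ < ‖h z‖}

lemma norm_update_le_of_mem_dominationCone [NormedField 𝕜] [Fintype ι] [DecidableEq ι]
    {h : (ι → 𝕜) → 𝕜} {z : ι → 𝕜} (hz : z ∈ dominationCone h i) :
    ‖Function.update z i (h z)‖ ≤ ‖h z‖ := by
  rw [pi_norm_le_iff_of_nonneg (norm_nonneg _)]
  intro j
  rcases eq_or_ne j i with rfl | hj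
  · rw [Function.update_self]
  · rw [Function.update_of_ne hj]
    exact (hz.2 j hj).le

lemma exists_openPartialHomeomorph_update_self [RCLike 𝕜] [Fintype ι] [DecidableEq ι]
    {h : (ι → 𝕜) → 𝕜} (hh : AnalyticAt 𝕜 h 0) (hh0 : h 0 = 0) {c : 𝕜} (hc : c ≠ 0)
    (hdh : ∀ v, fderiv 𝕜 h 0 v = c * v i) :
    ∃ e : OpenPartialHomeomorph (ι → 𝕜) (ι → 𝕜), (∀ z, e z = Function.update z i (h z)) ∧
      0 ∈ e.source ∧ AnalyticAt 𝕜 e.symm 0 := by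
  obtain ⟨e, he, hsource, -, -, hsymm⟩ := exists_openPartialHomeomorph_update (i := i)
    (f := id) (u := Function.update 1 i c) analyticAt_id hh rfl hh0
    (fun j => by rcases eq_or_ne j i with rfl | hj <;> simp [*]) (fun v j hj => by simp [hj])
    (fun v => by simp [hdh])
  exact ⟨e, he, hsource, hsymm⟩

lemma isBigO_norm_dominationCone [RCLike 𝕜] [Fintype ι] {h : (ι → 𝕜) → 𝕜}
    (hh : AnalyticAt 𝕜 h 0) (hh0 : h 0 = 0) {c : 𝕜} (hc : c ≠ 0)
    (hdh : ∀ v, fderiv 𝕜 h 0 v = c * v i) :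
    (fun z => ‖z‖) =O[𝓝[dominationCone h i] 0] h := by
  classical
  obtain ⟨e, he, hsource, hsymm⟩ := exists_openPartialHomeomorph_update_self hh hh0 hc hdh
  have he0 : e 0 = 0 := by simp [he, hh0]
  have hsymm0 : e.symm 0 = 0 := by rw [← he0, e.left_inv hsource, he0]
  have hcont : Tendsto e (𝓝 0) (𝓝 0) := by simpa [he0] using (e.continuousAt hsource).tendsto
  have hchart : (fun z => ‖z‖) =O[𝓝 0] fun z => ‖e z‖ := by
    refine ((isBigO_norm_of_map_zero hsymm.differentiableAt hsymm0).comp_tendsto hcont).congr'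
      ?_ .rfl
    filter_upwards [e.open_source.mem_nhds hsource] with z hz
    rw [Function.comp_apply, e.left_inv hz]
  refine (hchart.mono nhdsWithin_le_nhds).trans (IsBigO.of_bound' ?_)
  filter_upwards [self_mem_nhdsWithin] with z hz
  rw [norm_norm, he]
  exact norm_update_le_of_mem_dominationCone hz

variable [NontriviallyNormedField 𝕜] [Fintype ι] {h : (ι → 𝕜) → 𝕜} {F : (ι → 𝕜) → (ι → 𝕜)}
  {lam : ι → 𝕜}

lemma eventually_norm_apply_lt (hF : DifferentiableAt 𝕜 F 0) (hF0 : F 0 = 0)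
    (hdiag : ∀ v j, fderiv 𝕜 F 0 v j = lam j * v j) {j : ι} (hj : j ≠ i) (hlt : ‖lam j‖ < ‖lam i‖)
    (hO : (fun z => ‖z‖) =O[𝓝[dominationCone h i] 0] h)
    (hratio : Tendsto (fun z => h (F z) / (lam i * h z)) (𝓝[dominationCone h i] 0) (𝓝 1)) :
    ∀ᶠ z in 𝓝[dominationCone h i] 0, ‖F z j‖ < ‖h (F z)‖ := by
  obtain ⟨ρ, hjρ, hρi⟩ := exists_between hlt
  have hi0 : 0 < ‖lam i‖ := (norm_nonneg _).trans_lt hlt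
  have hlin := ((isLittleO_apply_sub_mul hF hF0 hdiag j).norm_right.mono
    nhdsWithin_le_nhds).trans_isBigO hO
  have hgrow : ∀ᶠ z in 𝓝[dominationCone h i] 0, ρ / ‖lam i‖ < ‖h (F z) / (lam i * h z)‖ :=
    hratio.norm.eventually_const_lt (by rwa [norm_one, div_lt_one hi0])
  filter_upwards [hlin.bound (sub_pos.2 hjρ), hgrow, self_mem_nhdsWithin] with z hbound hgrow hz
  have hz0 : 0 < ‖h z‖ := norm_pos_iff.2 hz.1
  calc ‖F z j‖ ≤ ‖F z j - lam j * z j‖ + ‖lam j * z j‖ := norm_le_norm_sub_add _ _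
    _ ≤ (ρ - ‖lam j‖) * ‖h z‖ + ‖lam j‖ * ‖h z‖ := by
      rw [norm_mul]
      gcongr
      exact (hz.2 j hj).le
    _ = ρ * ‖h z‖ := by ring
    _ < ‖h (F z)‖ := by
      rw [norm_div, norm_mul, div_lt_div_iff₀ hi0 (by positivity), mul_left_comm] at hgrow
      rw [mul_comm] at hgrow
      exact lt_of_mul_lt_mul_right (by linarith) hi0.le

lemma eventually_mem_dominationCone (hF : DifferentiableAt 𝕜 F 0) (hF0 : F 0 = 0)
    (hdiag : ∀ v j, fderiv 𝕜 F 0 v j = lam j * v j) (hlt : ∀ j ≠ i, ‖lam j‖ < ‖lam i‖)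
    (hO : (fun z => ‖z‖) =O[𝓝[dominationCone h i] 0] h)
    (hratio : Tendsto (fun z => h (F z) / (lam i * h z)) (𝓝[dominationCone h i] 0) (𝓝 1)) :
    ∀ᶠ z in 𝓝[dominationCone h i] 0, F z ∈ dominationCone h i := by
  have hcoord : ∀ᶠ z in 𝓝[dominationCone h i] 0, ∀ j ≠ i, ‖F z j‖ < ‖h (F z)‖ :=
    eventually_all.2 fun j => eventually_imp_distrib_left.2 fun hj =>
      eventually_norm_apply_lt hF hF0 hdiag hj (hlt j hj) hO hratio
  filter_upwards [hcoord, hratio.eventually_ne one_ne_zero] with z hz hne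
  exact ⟨fun h0 => hne (by simp [h0]), hz⟩

end Cone

section PetalChart

variable {ι : Type*}

/-- The points whose `i`-th coordinate lies in `S` and strictly dominates the other coordinates. -/
def coneOver {𝕜 : Type*} [Norm 𝕜] (i : ι) (S : Set 𝕜) : Set (ι → 𝕜) :=
  {y | y i ∈ S ∧ ∀ j ≠ i, ‖y j‖ < ‖y i‖}

lemma isOpen_coneOver {𝕜 : Type*} [SeminormedAddGroup 𝕜] [Finite ι] {S : Set 𝕜} (hS : IsOpen S)
    (i : ι) : IsOpen (coneOver i S) := by
  simp only [coneOver, ofPred_and, ofPred_forall]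
  exact (hS.preimage (continuous_apply i)).inter <| isOpen_iInter_of_finite fun j =>
    isOpen_iInter_of_finite fun _ =>
      isOpen_lt (continuous_apply j).norm (continuous_apply i).norm

lemma coneOver_eq_image {𝕜 : Type*} [RCLike 𝕜] [Fintype ι] [DecidableEq ι] {S : Set 𝕜}
    (hS : 0 ∉ S) (i : ι) :
    coneOver i S =
      (fun p : 𝕜 × (ι → 𝕜) => Function.update (‖p.1‖ • p.2) i p.1) '' S ×ˢ Metric.ball 0 1 := by
  ext y
  constructor
  · rintro ⟨hyS, hy⟩
    have hy0 : 0 < ‖y i‖ := norm_pos_iff.2 fun h => hS (h ▸ hyS)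
    refine ⟨(y i, Function.update (‖y i‖⁻¹ • y) i 0), ⟨hyS, ?_⟩, ?_⟩
    · rw [mem_ball_zero_iff, pi_norm_lt_iff one_pos]
      intro j
      rcases eq_or_ne j i with rfl | hj
      · simp
      · simpa [hj, norm_smul, inv_mul_lt_iff₀ hy0] using hy j hj
    · ext j
      rcases eq_or_ne j i with rfl | hj
      · simp
      · simp [hj, hy0.ne']
  · rintro ⟨⟨x, ζ⟩, ⟨hx, hζ⟩, rfl⟩
    have hx0 : 0 < ‖x‖ := norm_pos_iff.2 fun h => hS (h ▸ hx)
    refine ⟨by simpa using hx, fun j hj => ?_⟩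
    simp only [Function.update_of_ne hj, Function.update_self, Pi.smul_apply, norm_smul, norm_norm]
    exact mul_lt_of_lt_one_right hx0 ((norm_le_pi_norm ζ j).trans_lt (mem_ball_zero_iff.1 hζ))

lemma isPreconnected_coneOver {𝕜 : Type*} [RCLike 𝕜] [Finite ι] {S : Set 𝕜}
    (hS : IsPreconnected S) (hS0 : 0 ∉ S) (i : ι) : IsPreconnected (coneOver i S) := by
  classical
  cases nonempty_fintype ι
  have hcont : Continuous fun p : 𝕜 × (ι → 𝕜) => ‖p.1‖ • p.2 :=
    continuous_fst.norm.smul continuous_snd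
  rw [coneOver_eq_image hS0]
  exact (hS.prod (convex_ball _ _).isPreconnected).image _
    (hcont.update i continuous_fst).continuousOn

lemma exists_mem_of_le_norm_div_pow {𝕜 : Type*} [NormedField 𝕜] [Finite ι] (i : ι) (c : 𝕜) (d : ℕ)
    {O : Set (ι → 𝕜)} (hO : O ∈ 𝓝 0) :
    ∃ R : ℝ, 0 < R ∧ ∀ y ∈ coneOver i {0}ᶜ, R ≤ ‖(c / y i) ^ d‖ → y ∈ O := by
  cases nonempty_fintype ι
  obtain ⟨ε, hε, hball⟩ := Metric.mem_nhds_iff.1 hO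
  refine ⟨(‖c‖ / ε) ^ d + 1, by positivity, fun y ⟨hy0, hy⟩ hR => hball ?_⟩
  have hlt : ‖y i‖ < ε := by
    by_contra! hle
    have hpow : ‖(c / y i) ^ d‖ ≤ (‖c‖ / ε) ^ d := by
      rw [norm_pow, norm_div]
      gcongr
    linarith
  rw [mem_ball_zero_iff, pi_norm_lt_iff hε]
  intro j
  rcases eq_or_ne j i with rfl | hj
  · exact hlt
  · exact (hy j hj).trans hlt

variable {i : ι} {l c : ℂ} {d : ℕ} {R : ℝ} {μ : ℂ} {F : (ι → ℂ) → (ι → ℂ)}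
  {e : OpenPartialHomeomorph (ι → ℂ) (ι → ℂ)}

lemma isPreconnected_petal (hR : 0 ≤ R) : IsPreconnected (petal c d R μ) :=
  (convex_halfSpace_re_gt R).isPreconnected.image _ fun _ hu =>
    (continuousAt_const.mul (continuousAt_petalRoot (hR.trans_lt hu))).continuousWithinAt

/-- The part of the domain of the chart `e` which `e` maps into the cone over the petal in the
direction `μ` of the `i`-th coordinate line. -/
def chartPetal (e : OpenPartialHomeomorph (ι → ℂ) (ι → ℂ)) (i : ι) (c : ℂ) (d : ℕ) (R : ℝ)
    (μ : ℂ) : Set (ι → ℂ) :=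
  e.source ∩ e ⁻¹' coneOver i (petal c d R μ)

/-- The Fatou coordinate of the chart `e`, with the junk value `0` where `e z i = 0`. -/
noncomputable def fatouCoordinate (e : OpenPartialHomeomorph (ι → ℂ) (ι → ℂ)) (i : ι) (c : ℂ)
    (d : ℕ) (z : ι → ℂ) : ℂ :=
  (c / e z i) ^ d

/-- The chart `e` around `0` exhibits the petals of `F` in the `i`-th direction: on the petal in
the direction of each `d`-th root of unity `μ`, the map `F` is close to the unit translation of the
Fatou coordinate, and it sends this petal into the one in the direction `l * μ`. -/
structure IsPetalChart (F : (ι → ℂ) → (ι → ℂ)) (i : ι) (l c : ℂ) (d : ℕ) (R : ℝ)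
    (e : OpenPartialHomeomorph (ι → ℂ) (ι → ℂ)) : Prop where
  ne_zero : c ≠ 0
  order_ne_zero : d ≠ 0
  pow_eq_one : l ^ d = 1
  nonneg : 0 ≤ R
  zero_mem_source : 0 ∈ e.source
  map_zero : e 0 = 0
  subset_target : ∀ μ, μ ^ d = 1 → coneOver i (petal c d R μ) ⊆ e.target
  mapsTo : ∀ μ, μ ^ d = 1 → MapsTo F (chartPetal e i c d R μ) (chartPetal e i c d R (l * μ))
  norm_translation_le : ∀ μ, μ ^ d = 1 → ∀ z ∈ chartPetal e i c d R μ,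
    ‖fatouCoordinate e i c d (F z) - fatouCoordinate e i c d z - 1‖ ≤ 1 / 4

namespace IsPetalChart

lemma zero_notMem_petal (hP : IsPetalChart F i l c d R e) (hμ : μ ^ d = 1) : 0 ∉ petal c d R μ :=
  fun h => ne_zero_of_mem_petal hP.ne_zero hP.order_ne_zero hP.nonneg hμ h rfl

lemma mem_coneOver_compl (hP : IsPetalChart F i l c d R e) (hμ : μ ^ d = 1) {y : ι → ℂ}
    (hy : y ∈ coneOver i (petal c d R μ)) : y ∈ coneOver i {0}ᶜ :=
  ⟨fun h => hP.zero_notMem_petal hμ (h ▸ hy.1), hy.2⟩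

lemma tendsto_symm (hP : IsPetalChart F i l c d R e) : Tendsto e.symm (𝓝 0) (𝓝 0) := by
  simpa only [hP.map_zero] using e.tendsto_symm hP.zero_mem_source

lemma symm_image_coneOver (hP : IsPetalChart F i l c d R e) (hμ : μ ^ d = 1) :
    e.symm '' coneOver i (petal c d R μ) = chartPetal e i c d R μ :=
  e.symm_image_eq_source_inter_preimage (hP.subset_target μ hμ)

lemma isOpen_chartPetal [Finite ι] (hP : IsPetalChart F i l c d R e) (hμ : μ ^ d = 1) :
    IsOpen (chartPetal e i c d R μ) :=
  e.isOpen_inter_preimage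
    (isOpen_coneOver (isOpen_petal hP.ne_zero hP.order_ne_zero hP.nonneg hμ) i)

lemma isPreconnected_chartPetal [Finite ι] (hP : IsPetalChart F i l c d R e) (hμ : μ ^ d = 1) :
    IsPreconnected (chartPetal e i c d R μ) := by
  rw [← hP.symm_image_coneOver hμ]
  exact (isPreconnected_coneOver (isPreconnected_petal hP.nonneg) (hP.zero_notMem_petal hμ)
    i).image _ (e.continuousOn_symm.mono (hP.subset_target μ hμ))

lemma disjoint_chartPetal (hP : IsPetalChart F i l c d R e) {μ' : ℂ} (hμ : μ ^ d = 1)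
    (hμ' : μ' ^ d = 1) (hne : μ ≠ μ') :
    Disjoint (chartPetal e i c d R μ) (chartPetal e i c d R μ') :=
  Set.disjoint_left.2 fun _ hz hz' => Set.disjoint_left.1
    (disjoint_petal hP.ne_zero hP.order_ne_zero hP.nonneg hμ hμ' hne) hz.2.1 hz'.2.1

lemma zero_notMem_chartPetal (hP : IsPetalChart F i l c d R e) (hμ : μ ^ d = 1) :
    0 ∉ chartPetal e i c d R μ := fun h => by
  have h0 := h.2.1
  rw [hP.map_zero] at h0
  exact hP.zero_notMem_petal hμ h0

lemma lt_re_fatouCoordinate (hP : IsPetalChart F i l c d R e) (hμ : μ ^ d = 1) {z : ι → ℂ}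
    (hz : z ∈ chartPetal e i c d R μ) : R < (fatouCoordinate e i c d z).re :=
  ((mem_petal_iff hP.ne_zero hP.order_ne_zero hμ).1 hz.2.1).1

lemma exists_mem_of_le_norm_fatouCoordinate [Finite ι] (hP : IsPetalChart F i l c d R e)
    {O : Set (ι → ℂ)} (hO : O ∈ 𝓝 0) :
    ∃ R' : ℝ, ∀ μ, μ ^ d = 1 → ∀ z ∈ chartPetal e i c d R μ,
      R' ≤ ‖fatouCoordinate e i c d z‖ → z ∈ O := by
  obtain ⟨R', -, hmem⟩ := exists_mem_of_le_norm_div_pow i c d (hP.tendsto_symm hO)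
  refine ⟨R', fun μ hμ z hz hle => ?_⟩
  rw [← e.left_inv hz.1]
  exact hmem (e z) (hP.mem_coneOver_compl hμ hz.2) hle

lemma eventually_lt_norm_fatouCoordinate (hP : IsPetalChart F i l c d R e) (R' : ℝ) :
    ∀ᶠ z in 𝓝 (0 : ι → ℂ), ∀ μ, μ ^ d = 1 → z ∈ chartPetal e i c d R μ →
      R' < ‖fatouCoordinate e i c d z‖ := by
  have hcoord : Tendsto (fun z => e z i) (𝓝 0) (𝓝 0) := by
    simpa only [Function.comp_def, hP.map_zero, Pi.zero_apply] using
      ((continuous_apply i).continuousAt.comp (e.continuousAt hP.zero_mem_source)).tendsto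
  have hsmall : Tendsto (fun z => R' * ‖e z i‖ ^ d) (𝓝 0) (𝓝 0) := by
    simpa [hP.order_ne_zero] using (hcoord.norm.pow d).const_mul R'
  filter_upwards [hsmall.eventually_lt_const (pow_pos (norm_pos_iff.2 hP.ne_zero) d)]
    with z hz μ hμ hmem
  have hpos : 0 < ‖e z i‖ := norm_pos_iff.2 (hP.mem_coneOver_compl hμ hmem.2).1
  rwa [fatouCoordinate, norm_pow, norm_div, div_pow, lt_div_iff₀ (pow_pos hpos d)]

lemma zero_mem_closure_chartPetal [Finite ι] (hP : IsPetalChart F i l c d R e) (hμ : μ ^ d = 1) :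
    0 ∈ closure (chartPetal e i c d R μ) := by
  classical
  rw [mem_closure_iff_nhds]
  intro O hO
  obtain ⟨R', hR', hmem⟩ := exists_mem_of_le_norm_div_pow i c d (hP.tendsto_symm hO)
  set x : ℂ := μ * petalRoot c d (R + R' : ℝ) with hx
  have hxmem : x ∈ petal c d R μ := mul_petalRoot_mem_petal (by
    rw [Complex.ofReal_re]
    linarith)
  have hx0 : x ≠ 0 := fun h => hP.zero_notMem_petal hμ (h ▸ hxmem)
  have hcone : Pi.single i x ∈ coneOver i (petal c d R μ) :=
    ⟨by rwa [Pi.single_eq_same], fun j hj => by simpa [hj] using hx0⟩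
  refine ⟨e.symm (Pi.single i x), hmem _ (hP.mem_coneOver_compl hμ hcone) ?_,
    hP.symm_image_coneOver hμ ▸ mem_image_of_mem _ hcone⟩
  rw [Pi.single_eq_same, hx, div_petalRoot_pow hP.ne_zero hP.order_ne_zero hμ, Complex.norm_real,
    Real.norm_of_nonneg (add_nonneg hP.nonneg hR'.le)]
  exact le_add_of_nonneg_left hP.nonneg

end IsPetalChart

end PetalChart

section PetalChartOfCone

variable {ι : Type*} [DecidableEq ι] {F : (ι → ℂ) → (ι → ℂ)} {i : ι} {l c : ℂ} {d : ℕ}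
  {h : (ι → ℂ) → ℂ} {e : OpenPartialHomeomorph (ι → ℂ) (ι → ℂ)}

lemma preimage_coneOver_subset_dominationCone (he : ∀ z, e z = Function.update z i (h z))
    {S : Set ℂ} (hS : 0 ∉ S) : e ⁻¹' coneOver i S ⊆ dominationCone h i := by
  rintro z ⟨hz, hlt⟩
  simp only [he, Function.update_self] at hz hlt
  refine ⟨fun h0 => hS (h0 ▸ hz), fun j hj => ?_⟩
  simpa only [Function.update_of_ne hj] using hlt j hj

lemma exists_isPetalChart_of_eventually [Finite ι] (hF : Tendsto F (𝓝 0) (𝓝 0)) (hc : c ≠ 0)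
    (hd : d ≠ 0) (hl : l ^ d = 1) (he : ∀ z, e z = Function.update z i (h z))
    (hsource : 0 ∈ e.source) (hh0 : h 0 = 0)
    (hdyn : ∀ᶠ z in 𝓝[dominationCone h i] 0, F z ∈ dominationCone h i ∧
      ‖(c / h (F z)) ^ d - (c / h z) ^ d - 1‖ ≤ 1 / 4 ∧
      ∀ R : ℝ, 0 ≤ R → ∀ μ : ℂ, μ ^ d = 1 → h z ∈ petal c d R μ →
        h (F z) ∈ petal c d R (l * μ)) :
    ∃ R, IsPetalChart F i l c d R e := by
  have he0 : e 0 = 0 := by simp [he, hh0]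
  have he_self (z : ι → ℂ) : e z i = h z := by rw [he, Function.update_self]
  obtain ⟨W, hW, hFW⟩ := ((eventually_nhdsWithin_iff.1 hdyn).and
    (hF.eventually (e.open_source.mem_nhds hsource))).exists_mem
  have htarget : e.target ∩ e.symm ⁻¹' W ∈ 𝓝 0 := by
    rw [← he0]
    exact inter_mem (e.open_target.mem_nhds (e.map_source hsource)) (e.tendsto_symm hsource hW)
  obtain ⟨R, hR, hRmem⟩ := exists_mem_of_le_norm_div_pow i c d htarget
  have hpetal0 {μ : ℂ} (hμ : μ ^ d = 1) : 0 ∉ petal c d R μ :=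
    fun h0 => ne_zero_of_mem_petal hc hd hR.le hμ h0 rfl
  have hmem {μ : ℂ} (hμ : μ ^ d = 1) : coneOver i (petal c d R μ) ⊆ e.target ∩ e.symm ⁻¹' W :=
    fun y hy => hRmem y ⟨fun h0 => hpetal0 hμ (h0 ▸ hy.1), hy.2⟩
      (((mem_petal_iff hc hd hμ).1 hy.1).1.le.trans (Complex.re_le_norm _))
  have hdyn {μ : ℂ} (hμ : μ ^ d = 1) {z : ι → ℂ} (hz : z ∈ chartPetal e i c d R μ) := by
    have hzW : z ∈ W := by simpa only [mem_preimage, e.left_inv hz.1] using (hmem hμ hz.2).2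
    exact (hFW z hzW).imp_left fun H =>
      H (preimage_coneOver_subset_dominationCone he (hpetal0 hμ) hz.2)
  refine ⟨R, hc, hd, hl, hR.le, hsource, he0, fun μ hμ y hy => (hmem hμ hy).1,
    fun μ hμ z hz => ?_, fun μ hμ z hz => ?_⟩
  · obtain ⟨⟨hcone, -, hpetal⟩, hFz⟩ := hdyn hμ hz
    refine ⟨hFz, ?_, fun j hj => ?_⟩
    · rw [he_self]
      exact hpetal R hR.le μ hμ (he_self z ▸ hz.2.1)
    · rw [he_self, he, Function.update_of_ne hj]
      exact hcone.2 j hj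
  · simpa only [fatouCoordinate, he_self] using (hdyn hμ hz).1.2.1

end PetalChartOfCone

section PetalChartExistence

open Asymptotics

variable {n : ℕ} [NeZero n] {F : (Fin n → ℂ) → (Fin n → ℂ)} {lam : Fin n → ℂ} {q : ℕ}

lemma IsQuasiParabolic.eventually_dominationCone (hF : IsQuasiParabolic F lam q) {a c : ℂ} {d : ℕ}
    (hd : d ≠ 0) (hqd : lam 0 ^ d = 1) {h : (Fin n → ℂ) → ℂ}
    (hh : IsSemiconjugacy F (lam 0) a (d + 1) (d + 2) h) (hc : c ^ d * (d * (a / lam 0)) = -1) :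
    ∀ᶠ z in 𝓝[dominationCone h 0] 0, F z ∈ dominationCone h 0 ∧
      ‖(c / h (F z)) ^ d - (c / h z) ^ d - 1‖ ≤ 1 / 4 ∧
      ∀ R : ℝ, 0 ≤ R → ∀ μ : ℂ, μ ^ d = 1 → h z ∈ petal c d R μ →
        h (F z) ∈ petal c d R (lam 0 * μ) := by
  have hdiff := hF.analyticAt.differentiableAt
  have hl0 := hF.lam_zero_ne_zero
  have hc0 : c ≠ 0 := by
    rintro rfl
    simp [hd] at hc
  obtain ⟨c', hc', hdh⟩ :=
    hh.exists_fderiv_eq_mul (Nat.pos_of_ne_zero hd) hdiff hF.map_zero hF.fderiv_apply hF.lam_ne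
  have hO := isBigO_norm_dominationCone (i := 0) hh.analyticAt hh.map_zero hc' hdh
  have hdefect : (fun z => h (F z) - (lam 0 * h z + a * h z ^ (d + 1)))
      =O[𝓝[dominationCone h 0] 0] fun z => h z ^ (d + 2) :=
    (hh.isBigO.mono nhdsWithin_le_nhds).trans (hO.pow _)
  have hlim : Tendsto h (𝓝[dominationCone h 0] 0) (𝓝 0) := by
    simpa only [hh.map_zero] using hh.analyticAt.continuousAt.tendsto.mono_left nhdsWithin_le_nhds
  have hne : ∀ᶠ z in 𝓝[dominationCone h 0] 0, h z ≠ 0 :=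
    eventually_mem_nhdsWithin.mono fun z hz => hz.1
  have hratio := tendsto_div_mul_one hlim hne hl0 hd hdefect
  have htrans := ((tendsto_div_pow_sub_div_pow hlim hne hd hqd hdefect hc).sub_const 1).norm
  rw [sub_self, norm_zero] at htrans
  have hcone := eventually_mem_dominationCone hdiff hF.map_zero hF.fderiv_apply
    (fun j hj => hF.norm_lam_zero ▸ hF.norm_lt_one j hj) hO hratio
  filter_upwards [hcone, htrans.eventually_le_const (by norm_num : (0 : ℝ) < 1 / 4), hne,
    hratio.eventually (eventually_mul_mem_petal hc0 hd)] with z hFz hz hz0 hpetal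
  refine ⟨hFz, hz, fun R hR μ hμ hmem => ?_⟩
  have hstep := hpetal R hR (lam 0 * μ) (by rw [mul_pow, hqd, hμ, one_mul]) _
    (mul_mem_petal hmem (lam 0))
  rw [mul_div_cancel₀ _ (mul_ne_zero hl0 hz0)] at hstep
  refine hstep ?_
  have hre := ((mem_petal_iff hc0 hd hμ).1 hmem).1
  have hmove := (abs_le.1 ((Complex.abs_re_le_norm _).trans hz)).1
  simp only [Complex.sub_re, Complex.one_re] at hmove
  linarith

lemma IsQuasiParabolic.exists_isPetalChart (hF : IsQuasiParabolic F lam q) {a : ℂ} (ha : a ≠ 0)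
    {d : ℕ} (hd : d ≠ 0) (hqd : lam 0 ^ d = 1) {h : (Fin n → ℂ) → ℂ}
    (hh : IsSemiconjugacy F (lam 0) a (d + 1) (d + 2) h) :
    ∃ c R e, IsPetalChart F 0 (lam 0) c d R e := by
  obtain ⟨c, hc⟩ : ∃ c : ℂ, c ^ d * (d * (a / lam 0)) = -1 := by
    have hl0 := hF.lam_zero_ne_zero
    have hdC : (d : ℂ) ≠ 0 := Nat.cast_ne_zero.2 hd
    obtain ⟨c, hc⟩ :=
      IsAlgClosed.exists_pow_nat_eq (-(d * (a / lam 0))⁻¹) (Nat.pos_of_ne_zero hd)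
    exact ⟨c, by rw [hc]; field_simp⟩
  have hc0 : c ≠ 0 := by
    rintro rfl
    simp [hd] at hc
  obtain ⟨c', hc', hdh⟩ := hh.exists_fderiv_eq_mul (Nat.pos_of_ne_zero hd)
    hF.analyticAt.differentiableAt hF.map_zero hF.fderiv_apply hF.lam_ne
  obtain ⟨e, he, hsource, -⟩ :=
    exists_openPartialHomeomorph_update_self (i := 0) hh.analyticAt hh.map_zero hc' hdh
  have hlim : Tendsto F (𝓝 0) (𝓝 0) := by
    simpa only [hF.map_zero] using hF.analyticAt.continuousAt.tendsto
  obtain ⟨R, hP⟩ := exists_isPetalChart_of_eventually hlim hc0 hd hqd he hsource hh.map_zero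
    (hF.eventually_dominationCone hd hqd hh hc)
  exact ⟨c, R, e, hP⟩

end PetalChartExistence

section Basins

lemma connectedComponentIn_iUnion_eq {X ι : Type*} [TopologicalSpace X] {D : ι → Set X}
    (hopen : ∀ i, IsOpen (D i)) (hconn : ∀ i, IsPreconnected (D i))
    (hdisj : Pairwise fun i j => Disjoint (D i) (D j)) {i : ι} {x : X} (hx : x ∈ D i) :
    connectedComponentIn (⋃ j, D j) x = D i := by
  have hxU : x ∈ ⋃ j, D j := mem_iUnion.2 ⟨i, hx⟩
  refine Subset.antisymm ?_ ((hconn i).subset_connectedComponentIn hx (subset_iUnion D i))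
  have hrest : IsOpen (⋃ j ∈ {j | j ≠ i}, D j) := isOpen_biUnion fun j _ => hopen j
  refine isPreconnected_connectedComponentIn.subset_left_of_subset_union (hopen i) hrest ?_ ?_
    ⟨x, mem_connectedComponentIn hxU, hx⟩
  · rw [Set.disjoint_iUnion₂_right]
    exact fun j hj => hdisj (Ne.symm hj)
  · intro y hy
    obtain ⟨j, hj⟩ := mem_iUnion.1 (connectedComponentIn_subset _ _ hy)
    by_cases hji : j = i
    · exact Or.inl (hji ▸ hj)
    · exact Or.inr (mem_biUnion (show j ∈ {j | j ≠ i} from hji) hj)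

lemma hasBasis_nhds_mapsTo_inter {X : Type*} [TopologicalSpace X] {f : X → X} {B : Set X} {x : X}
    (H : ∀ t ∈ 𝓝 x, ∃ C ∈ 𝓝[B] x, C ⊆ t ∧ MapsTo f (B ∩ C) (B ∩ C)) :
    (𝓝 x).HasBasis (fun Ω => Ω ∈ {Ω | Ω ∈ 𝓝 x ∧ MapsTo f (B ∩ Ω) (B ∩ Ω)}) id := by
  refine ⟨fun t => ⟨fun ht => ?_, fun ⟨Ω, hΩ, hΩt⟩ => mem_of_superset hΩ.1 hΩt⟩⟩
  obtain ⟨C, hC, hCt, hmaps⟩ := H t ht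
  have hinter : B ∩ (t \ B ∪ C) = B ∩ C := by
    ext z
    simp +contextual
  refine ⟨t \ B ∪ C, ⟨?_, by rwa [hinter]⟩, union_subset sdiff_subset hCt⟩
  filter_upwards [ht, mem_nhdsWithin_iff_eventually.1 hC] with z hzt hzC
  exact (em (z ∈ B)).symm.imp (fun hzB => ⟨hzt, hzB⟩) hzC

lemma pow_zmodVal_add_one {M : Type*} [Monoid M] {q : ℕ} [NeZero q] {l : M} (hl : l ^ q = 1)
    (p : ZMod q) : l ^ (p + 1).val = l * l ^ p.val := by
  rw [← pow_succ']
  refine pow_eq_pow_of_modEq ?_ hl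
  rw [← ZMod.natCast_eq_natCast_iff]
  simp

/-- The union of the petals in the directions `l ^ p * ν`, which a map with multiplier `l`, a
`q`-th root of unity, permutes cyclically. -/
def petalCycle {ι : Type*} (e : OpenPartialHomeomorph (ι → ℂ) (ι → ℂ)) (i : ι) (c : ℂ) (d : ℕ)
    (R : ℝ) (l : ℂ) (q : ℕ) (ν : ℂ) : Set (ι → ℂ) :=
  ⋃ p : ZMod q, chartPetal e i c d R (l ^ p.val * ν)

namespace IsPetalChart

variable {ι : Type*} {F : (ι → ℂ) → (ι → ℂ)} {i : ι} {l c ν : ℂ} {d : ℕ} {R : ℝ} {q : ℕ}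
  {e : OpenPartialHomeomorph (ι → ℂ) (ι → ℂ)} {z : ι → ℂ}

section Translation

variable {μ : ℂ}

lemma re_fatouCoordinate_add_le (hP : IsPetalChart F i l c d R e) (hμ : μ ^ d = 1)
    (hz : z ∈ chartPetal e i c d R μ) :
    (fatouCoordinate e i c d z).re + 3 / 4 ≤ (fatouCoordinate e i c d (F z)).re := by
  have hre := (abs_le.1 ((Complex.abs_re_le_norm _).trans (hP.norm_translation_le μ hμ z hz))).1
  simp only [Complex.sub_re, Complex.one_re] at hre
  linarith

lemma re_add_abs_im_fatouCoordinate_lt (hP : IsPetalChart F i l c d R e) (hμ : μ ^ d = 1)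
    (hz : z ∈ chartPetal e i c d R μ) :
    (fatouCoordinate e i c d z).re + |(fatouCoordinate e i c d z).im| <
      (fatouCoordinate e i c d (F z)).re + |(fatouCoordinate e i c d (F z)).im| := by
  have hre := hP.re_fatouCoordinate_add_le hμ hz
  have him := (Complex.abs_im_le_norm _).trans (hP.norm_translation_le μ hμ z hz)
  simp only [Complex.sub_im, Complex.one_im, sub_zero] at him
  have habs := abs_sub_abs_le_abs_sub (fatouCoordinate e i c d z).im
    (fatouCoordinate e i c d (F z)).im
  rw [abs_sub_comm] at habs
  linarith

end Translation

lemma pow_mul_pow_eq_one (hP : IsPetalChart F i l c d R e) (hν : ν ^ d = 1) (m : ℕ) :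
    (l ^ m * ν) ^ d = 1 := by
  rw [mul_pow, pow_right_comm, hP.pow_eq_one, one_pow, one_mul, hν]

lemma exists_mem_chartPetal (hP : IsPetalChart F i l c d R e) (hν : ν ^ d = 1)
    (hz : z ∈ petalCycle e i c d R l q ν) : ∃ μ, μ ^ d = 1 ∧ z ∈ chartPetal e i c d R μ := by
  obtain ⟨p, hp⟩ := mem_iUnion.1 hz
  exact ⟨_, hP.pow_mul_pow_eq_one hν _, hp⟩

lemma disjoint_petalCycle (hP : IsPetalChart F i l c d R e) (hl : l ^ q = 1) {ν' : ℂ}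
    (hν : ν ^ d = 1) (hν' : ν' ^ d = 1) (hne : ν ^ q ≠ ν' ^ q) :
    Disjoint (petalCycle e i c d R l q ν) (petalCycle e i c d R l q ν') := by
  have hpow (m : ℕ) (w : ℂ) : (l ^ m * w) ^ q = w ^ q := by
    rw [mul_pow, pow_right_comm, hl, one_pow, one_mul]
  refine Set.disjoint_iUnion_left.2 fun p => Set.disjoint_iUnion_right.2 fun p' =>
    hP.disjoint_chartPetal (hP.pow_mul_pow_eq_one hν _) (hP.pow_mul_pow_eq_one hν' _) fun heq =>
      hne ?_
  rw [← hpow p.val, heq, hpow]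

section Topology

variable [Finite ι]

lemma isOpen_petalCycle (hP : IsPetalChart F i l c d R e) (hν : ν ^ d = 1) :
    IsOpen (petalCycle e i c d R l q ν) :=
  isOpen_iUnion fun _ => hP.isOpen_chartPetal (hP.pow_mul_pow_eq_one hν _)

lemma zero_mem_closure_petalCycle (hP : IsPetalChart F i l c d R e) (hν : ν ^ d = 1) :
    0 ∈ closure (petalCycle e i c d R l q ν) :=
  closure_mono (subset_iUnion_of_subset 0 Subset.rfl)
    (hP.zero_mem_closure_chartPetal (hP.pow_mul_pow_eq_one hν _))

lemma zero_mem_frontier_petalCycle (hP : IsPetalChart F i l c d R e) (hν : ν ^ d = 1) :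
    0 ∈ frontier (petalCycle e i c d R l q ν) := by
  rw [(hP.isOpen_petalCycle hν).frontier_eq]
  refine ⟨hP.zero_mem_closure_petalCycle hν, fun h0 => ?_⟩
  obtain ⟨μ, hμ, hmem⟩ := hP.exists_mem_chartPetal hν h0
  exact hP.zero_notMem_chartPetal hμ hmem

end Topology

variable [NeZero q]

lemma mapsTo_chartPetal_add_one (hP : IsPetalChart F i l c d R e) (hl : l ^ q = 1)
    (hν : ν ^ d = 1) (p : ZMod q) :
    MapsTo F (chartPetal e i c d R (l ^ p.val * ν))
      (chartPetal e i c d R (l ^ (p + 1).val * ν)) := by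
  rw [pow_zmodVal_add_one hl, mul_assoc]
  exact hP.mapsTo _ (hP.pow_mul_pow_eq_one hν _)

lemma mapsTo_petalCycle (hP : IsPetalChart F i l c d R e) (hl : l ^ q = 1) (hν : ν ^ d = 1) :
    MapsTo F (petalCycle e i c d R l q ν) (petalCycle e i c d R l q ν) := by
  intro z hz
  obtain ⟨p, hp⟩ := mem_iUnion.1 hz
  exact mem_iUnion.2 ⟨p + 1, hP.mapsTo_chartPetal_add_one hl hν p hp⟩

lemma mul_le_re_fatouCoordinate_iterate (hP : IsPetalChart F i l c d R e) (hl : l ^ q = 1)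
    (hν : ν ^ d = 1) (hz : z ∈ petalCycle e i c d R l q ν) (m : ℕ) :
    m * (3 / 4) ≤ (fatouCoordinate e i c d (F^[m] z)).re := by
  induction m with
  | zero =>
    obtain ⟨μ, hμ, hmem⟩ := hP.exists_mem_chartPetal hν hz
    simpa using hP.nonneg.trans (hP.lt_re_fatouCoordinate hμ hmem).le
  | succ m ih =>
    obtain ⟨μ, hμ, hmem⟩ :=
      hP.exists_mem_chartPetal hν ((hP.mapsTo_petalCycle hl hν).iterate m hz)
    have hstep := hP.re_fatouCoordinate_add_le hμ hmem
    rw [Function.iterate_succ_apply']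
    push_cast
    linarith

lemma tendsto_iterate [Finite ι] (hP : IsPetalChart F i l c d R e) (hl : l ^ q = 1)
    (hν : ν ^ d = 1) (hz : z ∈ petalCycle e i c d R l q ν) :
    Tendsto (fun m : ℕ => F^[m] z) atTop (𝓝 0) := by
  refine tendsto_def.2 fun O hO => ?_
  obtain ⟨R', hR'⟩ := hP.exists_mem_of_le_norm_fatouCoordinate hO
  have hlarge : ∀ᶠ m : ℕ in atTop, R' ≤ m * (3 / 4) :=
    (tendsto_natCast_atTop_atTop.atTop_mul_const (by norm_num)).eventually_ge_atTop R'
  filter_upwards [hlarge] with m hm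
  obtain ⟨μ, hμ, hmem⟩ :=
    hP.exists_mem_chartPetal hν ((hP.mapsTo_petalCycle hl hν).iterate m hz)
  exact hR' μ hμ _ hmem <|
    hm.trans ((hP.mul_le_re_fatouCoordinate_iterate hl hν hz m).trans (Complex.re_le_norm _))

/- In terms of the Fatou coordinate `u`, the sets `K < u.re` are forward invariant, but they are not
relative neighbourhoods of `0` in the petals; `u.re + |u.im|` also increases under `F`, and it is
comparable to `‖u‖`. -/
lemma hasBasis_nhds_mapsTo_petalCycle [Finite ι] (hP : IsPetalChart F i l c d R e) (hl : l ^ q = 1)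
    (hν : ν ^ d = 1) :
    (𝓝 0).HasBasis (fun Ω => Ω ∈ {Ω | Ω ∈ 𝓝 0 ∧ MapsTo F (petalCycle e i c d R l q ν ∩ Ω)
      (petalCycle e i c d R l q ν ∩ Ω)}) id := by
  refine hasBasis_nhds_mapsTo_inter fun t ht => ?_
  obtain ⟨R', hR'⟩ := hP.exists_mem_of_le_norm_fatouCoordinate ht
  set B := petalCycle e i c d R l q ν
  set u := fatouCoordinate e i c d
  have hpos {z : ι → ℂ} {μ : ℂ} (hμ : μ ^ d = 1) (hz : z ∈ chartPetal e i c d R μ) :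
      0 < (u z).re := hP.nonneg.trans_lt (hP.lt_re_fatouCoordinate hμ hz)
  refine ⟨{z | z ∈ B ∧ 2 * R' < (u z).re + |(u z).im|}, ?_, ?_, ?_⟩
  · filter_upwards [self_mem_nhdsWithin,
      (hP.eventually_lt_norm_fatouCoordinate (2 * R')).filter_mono nhdsWithin_le_nhds] with z hzB hz
    obtain ⟨μ, hμ, hmem⟩ := hP.exists_mem_chartPetal hν hzB
    refine ⟨hzB, (hz μ hμ hmem).trans_le ?_⟩
    simpa only [abs_of_pos (hpos hμ hmem)] using Complex.norm_le_abs_re_add_abs_im (u z)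
  · rintro z ⟨hzB, hz⟩
    obtain ⟨μ, hμ, hmem⟩ := hP.exists_mem_chartPetal hν hzB
    refine hR' μ hμ z hmem ?_
    linarith [Complex.re_le_norm (u z), Complex.abs_im_le_norm (u z)]
  · rintro z ⟨hzB, -, hz⟩
    obtain ⟨μ, hμ, hmem⟩ := hP.exists_mem_chartPetal hν hzB
    have hFz := hP.mapsTo_petalCycle hl hν hzB
    exact ⟨hFz, hFz, hz.trans (hP.re_add_abs_im_fatouCoordinate_lt hμ hmem)⟩

section Fin

variable {n : ℕ} {F : (Fin n → ℂ) → (Fin n → ℂ)} {i : Fin n}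
  {e : OpenPartialHomeomorph (Fin n → ℂ) (Fin n → ℂ)}

lemma isBasin_petalCycle (hP : IsPetalChart F i l c d R e) (hl : l ^ q = 1) (hν : ν ^ d = 1) :
    IsBasin F (petalCycle e i c d R l q ν) :=
  have hcl := hP.zero_mem_closure_petalCycle (q := q) hν
  ⟨closure_nonempty_iff.1 ⟨0, hcl⟩, hP.isOpen_petalCycle hν, hcl, _,
    hP.hasBasis_nhds_mapsTo_petalCycle hl hν,
    fun _ hΩ => ⟨hΩ.2, fun _ hz => hP.tendsto_iterate hl hν hz.1⟩⟩

lemma permutesComponentsCyclically (hP : IsPetalChart F i l c d R e) (hl : IsPrimitiveRoot l q)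
    (hν0 : ν ≠ 0) (hν : ν ^ d = 1) :
    PermutesComponentsCyclically F q (petalCycle e i c d R l q ν) := by
  set D : ZMod q → Set (Fin n → ℂ) := fun p => chartPetal e i c d R (l ^ p.val * ν)
  have hroot (p : ZMod q) : (l ^ p.val * ν) ^ d = 1 := hP.pow_mul_pow_eq_one hν _
  have hdisj : Pairwise fun p p' => Disjoint (D p) (D p') := fun p p' hpp' =>
    hP.disjoint_chartPetal (hroot p) (hroot p') fun heq => hpp' <| ZMod.val_injective q <|
      hl.pow_inj (ZMod.val_lt p) (ZMod.val_lt p') (mul_right_cancel₀ hν0 heq)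
  have hne (p : ZMod q) : (D p).Nonempty :=
    closure_nonempty_iff.1 ⟨0, hP.zero_mem_closure_chartPetal (hroot p)⟩
  have hcomp {p : ZMod q} {x : Fin n → ℂ} (hx : x ∈ D p) :
      connectedComponentIn (petalCycle e i c d R l q ν) x = D p :=
    connectedComponentIn_iUnion_eq (fun p => hP.isOpen_chartPetal (hroot p))
      (fun p => hP.isPreconnected_chartPetal (hroot p)) hdisj hx
  refine ⟨D, fun p p' heq => ?_, ?_, hP.mapsTo_chartPetal_add_one hl.pow_eq_one hν⟩
  · by_contra hpp'
    have hself : Disjoint (D p) (D p') := hdisj hpp'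
    rw [heq, disjoint_self] at hself
    exact (hne p').ne_empty hself
  · ext C
    constructor
    · rintro ⟨p, rfl⟩
      obtain ⟨x, hx⟩ := hne p
      exact ⟨x, mem_iUnion.2 ⟨p, hx⟩, (hcomp hx).symm⟩
    · rintro ⟨x, hx, rfl⟩
      obtain ⟨p, hp⟩ := mem_iUnion.1 hx
      exact ⟨p, (hcomp hp).symm⟩

end Fin

end IsPetalChart

lemma IsQuasiParabolic.exists_basins {n : ℕ} [NeZero n] {F : (Fin n → ℂ) → (Fin n → ℂ)}
    {lam : Fin n → ℂ} {q k : ℕ} (hF : IsQuasiParabolic F lam q)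
    (hk : HasResonantForm F lam 1 (Finsupp.single 0 q) k) :
    ∃ B : Fin k → Set (Fin n → ℂ), Pairwise (fun i j => Disjoint (B i) (B j)) ∧
      ∀ i, IsBasin F (B i) ∧ (0 : Fin n → ℂ) ∈ frontier (B i) ∧
        PermutesComponentsCyclically F q (B i) := by
  have : NeZero q := ⟨hF.pos.ne'⟩
  have hd : q * k ≠ 0 := (Nat.mul_pos hF.pos hk.1).ne'
  obtain ⟨a, ha, h, hh⟩ := hk.exists_isSemiconjugacy hF.map_zero
  obtain ⟨c, R, e, hP⟩ := hF.exists_isPetalChart ha hd (hF.pow_mul_eq_one k) hh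
  obtain ⟨ζ, hζ⟩ : ∃ ζ : ℂ, IsPrimitiveRoot ζ (q * k) := ⟨_, Complex.isPrimitiveRoot_exp _ hd⟩
  have hpow (m : ℕ) : (ζ ^ m) ^ (q * k) = 1 := by
    rw [pow_right_comm, hζ.pow_eq_one, one_pow]
  have hlq := hF.isPrimitiveRoot.pow_eq_one
  refine ⟨fun i => petalCycle e 0 c (q * k) R (lam 0) q (ζ ^ i.val), fun i j hij => ?_, fun i =>
    ⟨hP.isBasin_petalCycle hlq (hpow i), hP.zero_mem_frontier_petalCycle (hpow i),
      hP.permutesComponentsCyclically hF.isPrimitiveRoot (pow_ne_zero _ (hζ.ne_zero hd)) (hpow i)⟩⟩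
  refine hP.disjoint_petalCycle hlq (hpow i) (hpow j) fun heq => hij (Fin.ext ?_)
  rw [pow_right_comm, pow_right_comm ζ j.val] at heq
  exact (hζ.pow (Nat.pos_of_ne_zero hd) rfl).pow_inj i.2 j.2 heq

end Basins

theorem corollary6p1_general (n : ℕ) [NeZero n] (F : (Fin n → ℂ) → (Fin n → ℂ))
    (hF : AnalyticAt ℂ F 0) (hF0 : F 0 = 0) (lam : Fin n → ℂ)
    (hdiag : ∀ v j, fderiv ℂ F 0 v j = lam j * v j) (q : ℕ) (hq : 0 < q)
    (hprim : IsPrimitiveRoot (lam 0) q) (hattr : ∀ j : Fin n, j ≠ 0 → ‖lam j‖ < 1) :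
    IsOneResonant lam 1 (Finsupp.single 0 q) ∧
    (∀ k : ℕ, HasResonantForm F lam 1 (Finsupp.single 0 q) k →
      resonanceOrder F lam 1 (Finsupp.single 0 q) = k) ∧
    (∀ k : ℕ, resonanceOrder F lam 1 (Finsupp.single 0 q) = k →
      ∃ B : Fin k → Set (Fin n → ℂ), Pairwise (fun i j => Disjoint (B i) (B j)) ∧
        ∀ i, IsBasin F (B i) ∧ (0 : Fin n → ℂ) ∈ frontier (B i) ∧
          PermutesComponentsCyclically F q (B i)) ∧
    (resonanceOrder F lam 1 (Finsupp.single 0 q) = ⊤ ↔ FormallyLinearizable F lam 1) ∧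
    (FormallyLinearizable F lam 1 ↔ HasFixedCurve F^[q]) := by
  have hQ : IsQuasiParabolic F lam q := ⟨hF, hF0, hdiag, hq, hprim, hattr⟩
  exact ⟨hQ.isOneResonant, fun _ hk => hQ.resonanceOrder_eq hk,
    fun _ hk => hQ.exists_basins (hQ.hasResonantForm_of_resonanceOrder_eq hk),
    hQ.resonanceOrder_eq_top_iff, hQ.formallyLinearizable_iff_hasFixedCurve⟩

theorem corollary6p1 (n : ℕ) [NeZero n] (F : (Fin n → ℂ) → (Fin n → ℂ)) (hF : IsDiffGerm F)
    (lam : Fin n → ℂ) (hdiag : ∀ v j, fderiv ℂ F 0 v j = lam j * v j)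
    (q : ℕ) (hq : 0 < q) (hprim : IsPrimitiveRoot (lam 0) q)
    (hattr : ∀ j : Fin n, j ≠ 0 → ‖lam j‖ < 1) :
    -- `F` is one-resonant with respect to the first eigenvalue, with index `(q, 0, …, 0)`
    IsOneResonant lam 1 (Finsupp.single 0 q) ∧
    -- the order does not depend on the choice of the resonant form
    (∀ k : ℕ, HasResonantForm F lam 1 (Finsupp.single 0 q) k →
      resonanceOrder F lam 1 (Finsupp.single 0 q) = k) ∧
    -- finite order
    (∀ k : ℕ, resonanceOrder F lam 1 (Finsupp.single 0 q) = k →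
      ∃ B : Fin k → Set (Fin n → ℂ), Pairwise (fun i j => Disjoint (B i) (B j)) ∧
        ∀ i, IsBasin F (B i) ∧ (0 : Fin n → ℂ) ∈ frontier (B i) ∧
          PermutesComponentsCyclically F q (B i)) ∧
    -- infinite order
    (resonanceOrder F lam 1 (Finsupp.single 0 q) = ⊤ ↔ FormallyLinearizable F lam 1) ∧
    (FormallyLinearizable F lam 1 ↔ HasFixedCurve F^[q]) :=
  corollary6p1_general n F hF.1 hF.2.1 lam hdiag q hq hprim hattr
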